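/- Let $M=\mathbb R^n$ with coordinates $x^\mu$, let $S\subseteq \mathbb R^n\times\mathbb R$ be open with coordinates $(x^\mu,\psi)$, fibred by $(x,\psi)\mapsto x$, and let $J^k(S)$ be the space of $k$-jets of its local sections, with coordinates $(x^\mu,\psi,\psi_\mu,\dots,\psi_{\{\mu_1\dots\mu_k\}})$. Put $\partial^{\mu_1\dots\mu_l}=\frac{r_1!\cdots r_n!}{l!}\,\partial/\partial\psi_{\{\mu_1\dots\mu_l\}}$, where $r_\nu$ is the number of indices $\mu_i$ equal to $\nu$, and let $D_\mu$ be the total derivatives. Let $T=\mathcal T\,d\psi\wedge dx^1\wedge\dots\wedge dx^n$ with $\mathcal T\in C^\infty(J^2(S))$ be a second-order equation which is locally variational: near every point of $J^2(S)$ one has $\mathcal T=\sum_{l}(-1)^l\sum_{\mu_1,\dots,\mu_l} D_{\mu_1}\cdots D_{\mu_l}\,\partial^{\mu_1\dots\mu_l}\mathcal L$ for some smooth local Lagrangian $\mathcal L$ of some finite order. Let $\mathcal U$ be a family of subsets of $M$ (for example all open subsets, or $\mathcal U=\{M\}$). An evolution over an open set $U$ is a smooth section $x\mapsto(x,u(x))\in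 S$ over $U$; it is a solution if $\mathcal T$ vanishes on its 2-jets. Say that a diffeomorphism $\phi$ of $S$ maps solutions to solutions if, whenever $u$ is a solution over an open member of $\mathcal U$ and $\phi$ carries the graph of $u$, or of its restriction to an open subset, onto the graph of an evolution $v$ over an open set, $v$ is a solution. Let $\phi=(f,F)$ be a diffeomorphism of $S$ which is a symmetry, i.e. maps solutions to solutions, and assume the regularity conditions: 1. every point of $J^2(S)$ at which $\mathcal T=0$ is a limit of 2-jets of solutions over members of $\mathcal U$; 2. $\phi^{-1}$ also maps solutions to solutions, or else over every point of $J^1(S)$ there is a point of $J^2(S)$ at which $\mathcal T=0$. Let $\dot\phi$ be the natural lift of $\phi$ to $J^2(S)$, defined on the set $\Omega$ of 2-jets at which $\det(D_\nu f^\mu)\neq0$ (so $\Omega=J^2(S)$ if $\phi$ respects the fibration). Then there is a function $\rho$ on $\Omega$ such that on $\Omega$ $$(\dot\phi)^*T=\rho\,T,\qquad \partial^{\mu\nu}\rho=0\quad\text{for all }\mu,\nu,$$ and $\rho$ is $C^\infty$ near every point of $\Omega$ on whose fibre over $J^1(S)$ the function $\mathcal T$ and its differential $d\mathcal T$ do not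 both vanish identically. In particular, $\rho\in C^\infty(\Omega)$ if this holds on every fibre. -/

import Mathlib

open scoped ContDiff

noncomputable section

namespace ScalarJet

/-- Unordered multi-indices `{μ₁,…,μ_l}` with `l ≤ k` and entries in `{1,…,n}`. -/
abbrev MIdx (n k : ℕ) : Type := {s : Multiset (Fin n) // s.card ≤ k}

instance (n k : ℕ) : Finite (MIdx n k) :=
  Finite.of_surjective
    (fun p : Σ l : Fin (k + 1), Sym (Fin n) l =>
      (⟨p.2.1, by rw [p.2.2]; exact Nat.le_of_lt_succ p.1.2⟩ : MIdx n k))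
    (fun s => ⟨⟨⟨s.1.card, Nat.lt_succ_of_le s.2⟩, ⟨s.1, rfl⟩⟩, rfl⟩)

instance (n k : ℕ) : Fintype (MIdx n k) := Fintype.ofFinite _

/-- The coordinate space of `k`-jets of a scalar field `ψ` in `n` independent variables:
points are `(x, (ψ_s)_s)`, with one coordinate `ψ_s` for each multi-index `s` of length `≤ k`. -/
abbrev Jet (n k : ℕ) : Type := (Fin n → ℝ) × (MIdx n k → ℝ)

/-- The projection from `m`-jets to `k`-jets, `k ≤ m`. -/
def trunc {n m : ℕ} (k : ℕ) (h : k ≤ m) (j : Jet n m) : Jet n k :=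
  (j.1, fun s => j.2 ⟨s.1, s.2.trans h⟩)

/-- The projection of a jet to the point `(x, ψ)`. -/
def pt {n k : ℕ} (j : Jet n k) : (Fin n → ℝ) × ℝ := (j.1, j.2 ⟨0, by simp⟩)

/-- The space of `k`-jets over `S ⊆ ℝⁿ × ℝ`. -/
def jetsOver {n : ℕ} (S : Set ((Fin n → ℝ) × ℝ)) (k : ℕ) : Set (Jet n k) := {j | pt j ∈ S}

/-- The coordinate vector `∂/∂ψ_s`. -/
def eU {n k : ℕ} (s : MIdx n k) : Jet n k :=
  (0, Pi.single s 1)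

/-- The multi-index `{μ₁,…,μ_l}` of a sequence. -/
def midx {n k l : ℕ} (h : l ≤ k) (μ : Fin l → Fin n) : MIdx n k :=
  ⟨Finset.univ.val.map μ, by simpa using h⟩

/-- The operator `∂^{μ₁,…,μ_l} = (r₁! ⋯ r_n! / l!) ∂/∂ψ_{\{μ₁,…,μ_l\}}`, where `r_ν` is the number
of occurrences of `ν` among the `μ_i`. -/
def dUp {n k l : ℕ} (h : l ≤ k) (μ : Fin l → Fin n) (f : Jet n k → ℝ) : Jet n k → ℝ := fun j =>
  ((∏ ν : Fin n, ((midx h μ).1.count ν).factorial : ℕ) : ℝ) / (l.factorial : ℝ) *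
    fderiv ℝ f j (eU (midx h μ))

/-- The total derivative `D_μ f = ∂f/∂x^μ + ∑_s ψ_{s ∪ \{μ\}} ∂f/∂ψ_s`, from functions of `k`-jets
to functions of `(k+1)`-jets. -/
def totalD {n k : ℕ} (μ : Fin n) (f : Jet n k → ℝ) : Jet n (k + 1) → ℝ := fun j =>
  fderiv ℝ f (trunc k (Nat.le_succ k) j)
    (Pi.single μ 1, fun s => j.2 ⟨μ ::ₘ s.1, by simpa using s.2⟩)

/-- Iterated total derivatives `D_{μ₁} ⋯ D_{μ_l}`. -/
def iterD {n k : ℕ} (f : Jet n k → ℝ) : (l : ℕ) → (Fin l → Fin n) → (Jet n (k + l) → ℝ)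
  | 0, _ => f
  | l + 1, μ => totalD (μ (Fin.last l)) (iterD f l (fun i => μ i.castSucc))

/-- The Euler–Lagrange expression
`∑_{l} (-1)^l ∑_{μ₁,…,μ_l} D_{μ₁,…,μ_l} (∂^{μ₁,…,μ_l} L)` of a Lagrangian of order `r`. -/
def eulerLagrange {n r : ℕ} (L : Jet n r → ℝ) : Jet n (r + r) → ℝ := fun j =>
  ∑ l : Fin (r + 1), (-1 : ℝ) ^ (l : ℕ) *
    ∑ μ : Fin (l : ℕ) → Fin n,
      iterD (dUp (Nat.le_of_lt_succ l.2) μ L) l μ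
        (trunc (r + l) (Nat.add_le_add_left (Nat.le_of_lt_succ l.2) r) j)

/-- `T`, a function of second-order jets over `S`, is locally variational: near each jet it is the
Euler–Lagrange expression of a smooth local Lagrangian of some finite order. (A Lagrangian of order
less than two is in particular one of order two.) -/
def LocallyVariational {n : ℕ} (S : Set ((Fin n → ℝ) × ℝ)) (T : Jet n 2 → ℝ) : Prop :=
  ∀ j ∈ jetsOver S 2, ∃ (r : ℕ) (hr : 2 ≤ r) (W : Set (Jet n r)) (L : Jet n r → ℝ),
    IsOpen W ∧ j ∈ trunc 2 hr '' W ∧ ContDiffOn ℝ ∞ L W ∧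
      ∀ w : Jet n (r + r), trunc r (Nat.le_add_left r r) w ∈ W →
        T (trunc 2 (hr.trans (Nat.le_add_left r r)) w) = eulerLagrange L w

/-- Iterated partial derivatives of a function of `x` along a list of coordinates. -/
def partials {n : ℕ} (u : (Fin n → ℝ) → ℝ) : List (Fin n) → ((Fin n → ℝ) → ℝ)
  | [] => u
  | μ :: l => fun x => fderiv ℝ (partials u l) x (Pi.single μ 1)

/-- The `k`-jet at `x` of the section `x ↦ (x, u x)`. -/
def jet {n : ℕ} (k : ℕ) (u : (Fin n → ℝ) → ℝ) (x : Fin n → ℝ) : Jet n k :=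
  (x, fun s => partials u (s.1.sort (· ≤ ·)) x)

/-- `x ↦ (x, u x)` is a smooth evolution (section of `S`) over the open set `U`. -/
def IsEvolution {n : ℕ} (S : Set ((Fin n → ℝ) × ℝ)) (U : Set (Fin n → ℝ))
    (u : (Fin n → ℝ) → ℝ) : Prop :=
  IsOpen U ∧ ContDiffOn ℝ ∞ u U ∧ ∀ x ∈ U, (x, u x) ∈ S

/-- `x ↦ (x, u x)` is an evolution over `U` that solves the equation `T = 0`. -/
def IsSolution {n : ℕ} (S : Set ((Fin n → ℝ) × ℝ)) (T : Jet n 2 → ℝ) (U : Set (Fin n → ℝ))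
    (u : (Fin n → ℝ) → ℝ) : Prop :=
  IsEvolution S U u ∧ ∀ x ∈ U, T (jet 2 u x) = 0

/-- The image of the section `x ↦ (x, u x)` over `U`. -/
def sectionImage {n : ℕ} (U : Set (Fin n → ℝ)) (u : (Fin n → ℝ) → ℝ) : Set ((Fin n → ℝ) × ℝ) :=
  (fun x => (x, u x)) '' U

/-- `φ` maps solutions to solutions: whenever `u` is a solution over a member of `𝒰` and `φ` carries
(the restriction to an open set of) the section `u` to an evolution `v`, then `v` is a solution. -/
def MapsSolutions {n : ℕ} (S : Set ((Fin n → ℝ) × ℝ)) (T : Jet n 2 → ℝ)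
    (𝒰 : Set (Set (Fin n → ℝ))) (φ : (Fin n → ℝ) × ℝ → (Fin n → ℝ) × ℝ) : Prop :=
  ∀ U ∈ 𝒰, ∀ u, IsSolution S T U u → ∀ U₀ ⊆ U, IsOpen U₀ → ∀ V v, IsEvolution S V v →
    φ '' sectionImage U₀ u = sectionImage V v → IsSolution S T V v

/-- The set of second-order jets of the solutions over members of `𝒰`. -/
def solutionJets {n : ℕ} (S : Set ((Fin n → ℝ) × ℝ)) (T : Jet n 2 → ℝ)
    (𝒰 : Set (Set (Fin n → ℝ))) : Set (Jet n 2) :=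
  {j | ∃ U ∈ 𝒰, ∃ u, IsSolution S T U u ∧ ∃ x ∈ U, jet 2 u x = j}

/-- `φ` is a smooth diffeomorphism of `S` onto itself. -/
def IsDiffeoOf {n : ℕ} (S : Set ((Fin n → ℝ) × ℝ))
    (φ : OpenPartialHomeomorph ((Fin n → ℝ) × ℝ) ((Fin n → ℝ) × ℝ)) : Prop :=
  φ.source = S ∧ φ.target = S ∧ ContDiffOn ℝ ∞ φ S ∧ ContDiffOn ℝ ∞ φ.symm S

/-- The matrix `(D_ν f^μ)_{ν μ}` for `φ(x,ψ) = (f(x,ψ), F(x,ψ))`. -/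
def baseJac {n : ℕ} (φ : (Fin n → ℝ) × ℝ → (Fin n → ℝ) × ℝ) (j : Jet n 1) :
    Matrix (Fin n) (Fin n) ℝ :=
  Matrix.of fun ν μ => totalD ν (fun i : Jet n 0 => (φ (pt i)).1 μ) j

/-- The transformed derivative coordinates for `φ(x,ψ) = (f(x,ψ), F(x,ψ))`: `ψ' = F` and
`ψ'_{μ l}` is the solution of `∑_μ (D_ν f^μ) ψ'_{μ l} = D_ν ψ'_l`. -/
def liftCoord {n : ℕ} (φ : (Fin n → ℝ) × ℝ → (Fin n → ℝ) × ℝ) :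
    (l : List (Fin n)) → (Jet n l.length → ℝ)
  | [] => fun j => (φ (pt j)).2
  | μ :: l => fun j =>
      ((baseJac φ (trunc 1 (Nat.le_add_left 1 l.length) j))⁻¹.mulVec
        (fun ν => totalD ν (liftCoord φ l) j)) μ

/-- The natural lift of `φ` to `k`-jets; it is meaningful at the jets of `liftDomain`. -/
def lift {n : ℕ} (k : ℕ) (φ : (Fin n → ℝ) × ℝ → (Fin n → ℝ) × ℝ) (j : Jet n k) : Jet n k :=
  ((φ (pt j)).1, fun s =>
    liftCoord φ (s.1.sort (· ≤ ·)) (trunc _ (by simpa using s.2) j))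

/-- The second-order jets over `S` at which the lift of `φ` is defined, i.e. those of sections whose
image under `φ` is again locally a section: `det (D_ν f^μ) ≠ 0`. If `φ` respects the fibration
`(x,ψ) ↦ x`, these are all jets over `S`. -/
def liftDomain {n : ℕ} (S : Set ((Fin n → ℝ) × ℝ))
    (φ : (Fin n → ℝ) × ℝ → (Fin n → ℝ) × ℝ) : Set (Jet n 2) :=
  {j | j ∈ jetsOver S 2 ∧ (baseJac φ (trunc 1 one_le_two j)).det ≠ 0}

/-- The linear map `(dψ, dx¹, …, dxⁿ)` on tangent vectors of the space of `k`-jets. -/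
def coframe (n k : ℕ) : Jet n k →ₗ[ℝ] (Fin (n + 1) → ℝ) where
  toFun j := Fin.cons (pt j).2 (pt j).1
  map_add' i j := by ext a; refine Fin.cases ?_ (fun b => ?_) a <;> simp [pt]
  map_smul' c j := by ext a; refine Fin.cases ?_ (fun b => ?_) a <;> simp [pt]

/-- The `(n+1)`-form `T dψ ∧ dx¹ ∧ ⋯ ∧ dxⁿ` on the space of second-order jets. -/
def eqForm {n : ℕ} (T : Jet n 2 → ℝ) (j : Jet n 2) : Jet n 2 [⋀^Fin (n + 1)]→ₗ[ℝ] ℝ :=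
  T j • (Matrix.detRowAlternating (n := Fin (n + 1)) (R := ℝ)).compLinearMap (coframe n 2)

/-- The pull-back of a form along a map of the space of second-order jets. -/
def pullback {n : ℕ} (g : Jet n 2 → Jet n 2)
    (α : Jet n 2 → Jet n 2 [⋀^Fin (n + 1)]→ₗ[ℝ] ℝ) (j : Jet n 2) :
    Jet n 2 [⋀^Fin (n + 1)]→ₗ[ℝ] ℝ :=
  (α (g j)).compLinearMap (fderiv ℝ g j).toLinearMap

/-- Two second-order jets lie over the same first-order jet. -/
def SameFirstJet {n : ℕ} (i j : Jet n 2) : Prop :=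
  trunc 1 one_le_two i = trunc 1 one_le_two j

end ScalarJet

end

open ScalarJet

/-! ### Jets of functions, total derivatives along sections, Taylor polynomials -/

namespace ScalarJet

open Set Filter Topology

variable {n : ℕ}

/-! Local variationality enters through one consequence: `T` is affine in `t` along every line `j +
t k⊗k` in a fibre of `J²(S) → J¹(S)`. The linearization of `T` along a section comes from the second
variation of a local action, hence is formally self-adjoint (`integral_mul_fderiv_comm`, pointwise
`sum_adjoint_eq_linearization`). The adjoint differentiates the coefficients, so it formally
involves third derivatives of the section, while the linearization involves only second ones. Adding
the cubic `t (k·(x-a))³/6` to the section and testing with `k·(x-a)` isolates the third-order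
contribution. It is `2t` times the second derivative of `T` along `k⊗k`, which therefore vanishes
(`fderiv_fderiv_rankOne`).

The lift of `φ` maps each such line affinely into a line of the same kind
(`exists_lift_add_smul_rankOne`), so `Q = T ∘ lift` is also affine along these lines. The symmetry
and condition 1 make every zero of `T` in `Ω` a zero of `Q`. Where `T` has nonzero slope along
`k⊗k`, the line meets the zero set of `T`, and the vanishing of `Q` there reads `Q dT = T dQ` in the
direction `k⊗k`. If `T` is not constant on the fibre, nonzero slope is generic both in the point and
in `k`, so the identity holds in all directions and `Q = c T` on the fibre
(`AffineAlong.exists_eq_const_mul`). If `T` is a nonzero constant there, its zeros give no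
information. Condition 2 either excludes this case or makes `Q` zero-free, hence constant as well.

Since the lift covers `φ`, it pulls `dψ ∧ dx` back to the Jacobian of `φ` times itself
(`pullback_eqForm`), and `ρ` is this Jacobian times `c`. Both factors depend only on the first-order
jet. Smoothness of `c` is a division problem: near a point where `T` or `dT` is nonzero,
straightening `T` to a linear form and applying Hadamard's lemma gives a smooth quotient
(`exists_eventually_eq_mul`). Restricted to a local section of `J²(S) → J¹(S)`, this quotient agrees
with the limit of `c` from the fibres on which `T` is not identically zero
(`exists_contDiffAt_extendFrom`). -/

theorem contDiffOn_partials {u : (Fin n → ℝ) → ℝ} {U : Set (Fin n → ℝ)} (hU : IsOpen U)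
    (hu : ContDiffOn ℝ ∞ u U) (l : List (Fin n)) : ContDiffOn ℝ ∞ (partials u l) U := by
  induction l with
  | nil => exact hu
  | cons μ l ih => exact (ih.fderiv_of_isOpen hU (by simp)).clm_apply contDiffOn_const

theorem partials_eventuallyEq {u v : (Fin n → ℝ) → ℝ} {x : Fin n → ℝ} (h : u =ᶠ[𝓝 x] v)
    (l : List (Fin n)) : partials u l =ᶠ[𝓝 x] partials v l := by
  induction l with
  | nil => exact h
  | cons μ l ih =>
    filter_upwards [ih.fderiv (𝕜 := ℝ)] with y hy
    simp [partials, hy]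

theorem partials_append (u : (Fin n → ℝ) → ℝ) (l l' : List (Fin n)) :
    partials u (l ++ l') = partials (partials u l') l := by
  induction l with
  | nil => rfl
  | cons μ l ih => simp [partials, ih]

theorem fderiv_fderiv_apply_comm {E : Type*} [NormedAddCommGroup E] [NormedSpace ℝ E]
    {u : E → ℝ} {x : E} (hu : ContDiffAt ℝ ∞ u x) (v w : E) :
    fderiv ℝ (fun y => fderiv ℝ u y v) x w = fderiv ℝ (fun y => fderiv ℝ u y w) x v := by
  have hd : DifferentiableAt ℝ (fderiv ℝ u) x :=
    (hu.fderiv_right (m := 1) (by norm_num; exact ENat.LEInfty.out)).differentiableAt one_ne_zero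
  have hs : IsSymmSndFDerivAt ℝ u x := hu.isSymmSndFDerivAt (by simpa using ENat.LEInfty.out)
  have key : ∀ v w : E,
      fderiv ℝ (fun y => fderiv ℝ u y v) x w = fderiv ℝ (fderiv ℝ u) x w v := by
    intro v w
    rw [fderiv_clm_apply hd (differentiableAt_const v)]
    simp
  rw [key, key]
  exact hs w v

/-- `jet` reads a multi-index in sorted order; symmetry of second derivatives makes this choice
immaterial. -/
theorem partials_perm {u : (Fin n → ℝ) → ℝ} {U : Set (Fin n → ℝ)} (hU : IsOpen U)
    (hu : ContDiffOn ℝ ∞ u U) {l l' : List (Fin n)} (h : l.Perm l') :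
    EqOn (partials u l) (partials u l') U := by
  induction h with
  | nil => exact fun x _ => rfl
  | cons a _ ih =>
    intro x hx
    have : partials u _ =ᶠ[𝓝 x] partials u _ := ih.eventuallyEq_of_mem (hU.mem_nhds hx)
    simp [partials, this.fderiv_eq]
  | swap a b l =>
    intro x hx
    exact fderiv_fderiv_apply_comm ((contDiffOn_partials hU hu l).contDiffAt (hU.mem_nhds hx)) _ _
  | trans _ _ ih₁ ih₂ => exact fun x hx => (ih₁ hx).trans (ih₂ hx)

theorem jet_eventuallyEq {u v : (Fin n → ℝ) → ℝ} {x : Fin n → ℝ} (h : u =ᶠ[𝓝 x] v) (k : ℕ) :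
    jet k u =ᶠ[𝓝 x] jet k v := by
  have : ∀ᶠ y in 𝓝 x, ∀ s : MIdx n k,
      partials u (s.1.sort (· ≤ ·)) y = partials v (s.1.sort (· ≤ ·)) y :=
    eventually_all.2 fun s => partials_eventuallyEq h _
  filter_upwards [this] with y hy
  simp only [jet, hy]

@[simp]
theorem trunc_jet {k m : ℕ} (h : k ≤ m) (u : (Fin n → ℝ) → ℝ) (x : Fin n → ℝ) :
    trunc k h (jet m u x) = jet k u x := rfl

@[simp]
theorem trunc_trunc {k l m : ℕ} (h : k ≤ l) (h' : l ≤ m) (j : Jet n m) :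
    trunc k h (trunc l h' j) = trunc k (h.trans h') j := rfl

@[simp]
theorem pt_jet (k : ℕ) (u : (Fin n → ℝ) → ℝ) (x : Fin n → ℝ) : pt (jet k u x) = (x, u x) := by
  simp [pt, jet, partials]

theorem contDiffOn_jet {u : (Fin n → ℝ) → ℝ} {U : Set (Fin n → ℝ)} (hU : IsOpen U)
    (hu : ContDiffOn ℝ ∞ u U) (k : ℕ) : ContDiffOn ℝ ∞ (jet k u) U :=
  contDiffOn_id.prodMk (contDiffOn_pi.2 fun _ => contDiffOn_partials hU hu _)

theorem contDiff_trunc {k m : ℕ} (h : k ≤ m) : ContDiff ℝ ∞ (trunc (n := n) k h) :=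
  contDiff_fst.prodMk (contDiff_pi.2 fun _ => (contDiff_apply ℝ ℝ _).comp contDiff_snd)

theorem contDiff_pt {k : ℕ} : ContDiff ℝ ∞ (pt (n := n) (k := k)) :=
  contDiff_fst.prodMk ((contDiff_apply ℝ ℝ _).comp contDiff_snd)

theorem fderiv_jet {u : (Fin n → ℝ) → ℝ} {U : Set (Fin n → ℝ)} (hU : IsOpen U)
    (hu : ContDiffOn ℝ ∞ u U) (k : ℕ) {x : Fin n → ℝ} (hx : x ∈ U) (ν : Fin n) :
    fderiv ℝ (jet k u) x (Pi.single ν 1) =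
      (Pi.single ν 1, fun s => (jet (k + 1) u x).2 ⟨ν ::ₘ s.1, by simpa using s.2⟩) := by
  have hd : ∀ s : MIdx n k, DifferentiableAt ℝ (partials u (s.1.sort (· ≤ ·))) x := fun s =>
    ((contDiffOn_partials hU hu _).contDiffAt (hU.mem_nhds hx)).differentiableAt (by simp)
  have h : HasFDerivAt (jet k u) ((ContinuousLinearMap.id ℝ (Fin n → ℝ)).prod
      (ContinuousLinearMap.pi fun s : MIdx n k => fderiv ℝ (partials u (s.1.sort (· ≤ ·))) x)) x :=
    (hasFDerivAt_id x).prodMk (hasFDerivAt_pi.2 fun s => (hd s).hasFDerivAt)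
  rw [h.fderiv]
  refine Prod.ext rfl (funext fun s => ?_)
  change partials u (ν :: s.1.sort (· ≤ ·)) x = partials u ((ν ::ₘ s.1).sort (· ≤ ·)) x
  refine partials_perm hU hu ?_ hx
  rw [← Multiset.coe_eq_coe]
  simp [← Multiset.cons_coe]

/-- The chain rule. It turns identities between formal operators on jet space into identities
between ordinary derivatives along sections. -/
theorem totalD_jet {u : (Fin n → ℝ) → ℝ} {U : Set (Fin n → ℝ)} (hU : IsOpen U)
    (hu : ContDiffOn ℝ ∞ u U) {k : ℕ} {x : Fin n → ℝ} (hx : x ∈ U) {f : Jet n k → ℝ}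
    (hf : DifferentiableAt ℝ f (jet k u x)) (ν : Fin n) :
    totalD ν f (jet (k + 1) u x) = fderiv ℝ (fun y => f (jet k u y)) x (Pi.single ν 1) := by
  have hj : DifferentiableAt ℝ (jet k u) x :=
    ((contDiffOn_jet hU hu k).contDiffAt (hU.mem_nhds hx)).differentiableAt (by simp)
  have := fderiv_comp x hf hj
  change fderiv ℝ (f ∘ jet k u) x = _ at this
  change _ = fderiv ℝ (f ∘ jet k u) x _
  rw [this, ContinuousLinearMap.comp_apply, fderiv_jet hU hu k hx]
  rfl

theorem contDiffOn_totalD {k : ℕ} {W : Set (Jet n k)} (hW : IsOpen W) {f : Jet n k → ℝ}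
    (hf : ContDiffOn ℝ ∞ f W) (ν : Fin n) :
    ContDiffOn ℝ ∞ (totalD ν f) (trunc k (Nat.le_succ k) ⁻¹' W) := by
  refine ContDiffOn.clm_apply ((hf.fderiv_of_isOpen hW (by simp)).comp
    (contDiff_trunc _).contDiffOn fun _ h => h) ?_
  exact contDiffOn_const.prodMk (contDiff_pi.2 fun s =>
    (contDiff_apply ℝ ℝ _).comp contDiff_snd).contDiffOn

theorem contDiffOn_iterD {k : ℕ} {W : Set (Jet n k)} (hW : IsOpen W) {f : Jet n k → ℝ}
    (hf : ContDiffOn ℝ ∞ f W) (l : ℕ) (μ : Fin l → Fin n) :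
    ContDiffOn ℝ ∞ (iterD f l μ) (trunc k (Nat.le_add_right k l) ⁻¹' W) := by
  induction l with
  | zero => exact hf
  | succ l ih =>
    exact contDiffOn_totalD (hW.preimage (contDiff_trunc _).continuous) (ih _) _

theorem iterD_jet {u : (Fin n → ℝ) → ℝ} {U : Set (Fin n → ℝ)} (hU : IsOpen U)
    (hu : ContDiffOn ℝ ∞ u U) {k : ℕ} {W : Set (Jet n k)} (hW : IsOpen W) {f : Jet n k → ℝ}
    (hf : ContDiffOn ℝ ∞ f W) (hm : MapsTo (jet k u) U W) (l : ℕ) (μ : Fin l → Fin n) :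
    EqOn (fun x => iterD f l μ (jet (k + l) u x))
      (partials (fun x => f (jet k u x)) (List.ofFn μ).reverse) U := by
  induction l with
  | zero => exact fun x _ => rfl
  | succ l ih =>
    intro x hx
    have hd : DifferentiableAt ℝ (iterD f l fun i => μ i.castSucc) (jet (k + l) u x) :=
      ((contDiffOn_iterD hW hf l _).contDiffAt
        ((hW.preimage (contDiff_trunc _).continuous).mem_nhds (hm hx))).differentiableAt (by simp)
    -- `iterD` applies the last index outermost, `partials` the head of the list; hence the
    -- reversal.
    have hl : (List.ofFn μ).reverse =
        μ (Fin.last l) :: (List.ofFn fun i : Fin l => μ i.castSucc).reverse := by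
      rw [List.ofFn_succ', List.concat_eq_append]; simp
    have he := (ih fun i => μ i.castSucc).eventuallyEq_of_mem (hU.mem_nhds hx)
    rw [hl]
    change totalD _ _ (jet (k + l + 1) u x) = fderiv ℝ _ x _
    rw [totalD_jet hU hu hx hd, he.fderiv_eq]

/-- The monomial `∏_μ (x_μ - a_μ)^{r_μ} / r_μ!` of a multi-index. -/
noncomputable def taylorMonomial (a : Fin n → ℝ) (s : Multiset (Fin n)) (x : Fin n → ℝ) : ℝ :=
  ∏ μ, (x μ - a μ) ^ s.count μ / (s.count μ).factorial

theorem contDiff_taylorMonomial (a : Fin n → ℝ) (s : Multiset (Fin n)) :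
    ContDiff ℝ ∞ (taylorMonomial a s) := by
  unfold taylorMonomial
  fun_prop

theorem taylorMonomial_self (a : Fin n → ℝ) (s : Multiset (Fin n)) :
    taylorMonomial a s a = if s = 0 then 1 else 0 := by
  split_ifs with h
  · simp [taylorMonomial, h]
  · obtain ⟨μ, hμ⟩ := Multiset.exists_mem_of_ne_zero h
    refine Finset.prod_eq_zero (Finset.mem_univ μ) ?_
    simp [(Multiset.count_pos.2 hμ).ne']

/-- With divided powers, differentiation just removes an index from the multiset and no numerical
factor appears. -/
theorem fderiv_taylorMonomial (a : Fin n → ℝ) (s : Multiset (Fin n)) (μ : Fin n)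
    (x : Fin n → ℝ) :
    fderiv ℝ (taylorMonomial a s) x (Pi.single μ 1) =
      if μ ∈ s then taylorMonomial a (s.erase μ) x else 0 := by
  have h : HasLineDerivAt ℝ (taylorMonomial a s)
      (if μ ∈ s then taylorMonomial a (s.erase μ) x else 0) x (Pi.single μ 1) := by
    have he : ∀ t : ℝ, taylorMonomial a s (x + t • Pi.single μ 1) =
        (x μ + t - a μ) ^ s.count μ / (s.count μ).factorial *
          ∏ ν ∈ Finset.univ.erase μ, (x ν - a ν) ^ s.count ν / (s.count ν).factorial := by
      intro t
      unfold taylorMonomial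
      rw [← Finset.mul_prod_erase _ _ (Finset.mem_univ μ)]
      congr 1
      · simp
      · refine Finset.prod_congr rfl fun ν hν => ?_
        simp [Finset.ne_of_mem_erase hν]
    have hd : HasDerivAt (fun t : ℝ => (x μ + t - a μ) ^ s.count μ / (s.count μ).factorial)
        (s.count μ * (x μ + 0 - a μ) ^ (s.count μ - 1) * 1 / (s.count μ).factorial) 0 :=
      ((((hasDerivAt_id (0 : ℝ)).const_add (x μ)).sub_const (a μ)).pow _).div_const _
    unfold HasLineDerivAt
    simp only [he]
    refine (hd.mul_const _).congr_deriv ?_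
    symm
    split_ifs with hμ
    · obtain ⟨c, hc⟩ := Nat.exists_eq_succ_of_ne_zero (Multiset.count_pos.2 hμ).ne'
      unfold taylorMonomial
      rw [← Finset.mul_prod_erase _ _ (Finset.mem_univ μ)]
      congr 1
      · rw [Multiset.count_erase_self, hc, Nat.factorial_succ]
        have : (c.factorial : ℝ) ≠ 0 := by positivity
        have : (c + 1 : ℝ) ≠ 0 := by positivity
        push_cast
        simp
        field_simp
      · refine Finset.prod_congr rfl fun ν hν => ?_
        rw [Multiset.count_erase_of_ne (Finset.ne_of_mem_erase hν)]
    · simp [Multiset.count_eq_zero.2 hμ]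
  rw [← h.lineDeriv]
  exact ((contDiff_taylorMonomial a s).differentiable (by simp) x).lineDeriv_eq_fderiv.symm

theorem partials_taylorMonomial (a : Fin n → ℝ) (s : Multiset (Fin n)) (l : List (Fin n)) :
    partials (taylorMonomial a s) l =
      if (l : Multiset (Fin n)) ≤ s then taylorMonomial a (s - l) else 0 := by
  induction l with
  | nil => simp [partials]
  | cons μ l ih =>
    funext x
    change fderiv ℝ (partials (taylorMonomial a s) l) x _ = _
    rw [ih, ← Multiset.cons_coe]
    by_cases h : (l : Multiset (Fin n)) ≤ s
    · rw [if_pos h, fderiv_taylorMonomial]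
      have : μ ∈ s - (l : Multiset (Fin n)) ↔ μ ::ₘ (l : Multiset (Fin n)) ≤ s := by
        rw [← Multiset.singleton_add, ← le_tsub_iff_right h, Multiset.singleton_le]
      simp only [this]
      split_ifs
      · rw [← Multiset.sub_singleton, tsub_tsub, add_comm, Multiset.singleton_add]
      · rfl
    · have h' : ¬ μ ::ₘ (l : Multiset (Fin n)) ≤ s := fun h' =>
        h ((Multiset.le_cons_self _ _).trans h')
      rw [if_neg h, if_neg h']
      simp

theorem partials_finset_sum {ι : Type*} (A : Finset ι) (c : ι → ℝ)
    (u : ι → (Fin n → ℝ) → ℝ) (hu : ∀ i, ContDiff ℝ ∞ (u i)) (l : List (Fin n)) :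
    partials (fun x => ∑ i ∈ A, c i * u i x) l = fun x => ∑ i ∈ A, c i * partials (u i) l x := by
  induction l with
  | nil => rfl
  | cons μ l ih =>
    funext x
    have hd : ∀ i, DifferentiableAt ℝ (partials (u i) l) x := fun i =>
      ((contDiffOn_partials isOpen_univ (hu i).contDiffOn l).contDiffAt
        univ_mem).differentiableAt (by simp)
    simp only [partials, ih]
    rw [fderiv_fun_sum fun i _ => (hd i).const_mul (c i)]
    rw [sum_apply]
    refine Finset.sum_congr rfl fun i _ => ?_
    rw [fderiv_const_mul (hd i)]
    rfl

/-- The Taylor polynomial with the prescribed coefficients. Statements about points of jet space can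
therefore be proved along sections. -/
theorem exists_jet_eq {k : ℕ} (j : Jet n k) : ∃ u, ContDiff ℝ ∞ u ∧ jet k u j.1 = j := by
  refine ⟨fun x => ∑ s : MIdx n k, j.2 s * taylorMonomial j.1 s.1 x,
    ContDiff.sum fun s _ => contDiff_const.mul (contDiff_taylorMonomial _ _), ?_⟩
  refine Prod.ext rfl (funext fun t => ?_)
  change partials _ _ j.1 = _
  rw [partials_finset_sum _ _ _ fun s => contDiff_taylorMonomial _ _]
  beta_reduce
  rw [Finset.sum_eq_single t]
  · simp [partials_taylorMonomial, taylorMonomial_self]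
  · intro s _ hs
    rw [partials_taylorMonomial, Multiset.sort_eq]
    split_ifs with h
    · rw [taylorMonomial_self, if_neg, mul_zero]
      intro h0
      exact hs (Subtype.ext (le_antisymm (tsub_eq_zero_iff_le.1 h0) h))
    · simp
  · simp

end ScalarJet

/-! ### Smooth division (Hadamard's lemma) -/

namespace ScalarJet

open Set Filter Topology

/-- Differentiation under the integral sign, by induction on the order. The target `F` is
generalized because the derivative of the integrand takes values in `E →L[ℝ] F`. -/
theorem contDiff_intervalIntegral_param {E F : Type} [NormedAddCommGroup E] [NormedSpace ℝ E]
    [FiniteDimensional ℝ E] [NormedAddCommGroup F] [NormedSpace ℝ F] {p : ℝ × E → F}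
    (hp : ContDiff ℝ ∞ p) : ContDiff ℝ ∞ fun z => ∫ s in (0 : ℝ)..1, p (s, z) := by
  rw [contDiff_infty]
  intro m
  induction m generalizing F with
  | zero =>
    rw [Nat.cast_zero, contDiff_zero]
    exact intervalIntegral.continuous_parametric_intervalIntegral_of_continuous'
      (by fun_prop) 0 1
  | succ m ih =>
    let p' : ℝ × E → E →L[ℝ] F := fun w => (fderiv ℝ p w).comp (ContinuousLinearMap.inr ℝ ℝ E)
    have hp' : ContDiff ℝ ∞ p' :=
      (hp.fderiv_right (m := ∞) (by simp)).clm_comp contDiff_const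
    rw [Nat.cast_succ, contDiff_succ_iff_hasFDerivAt]
    refine ⟨_, ih hp', fun z => ?_⟩
    have hK : IsCompact (Icc (0 : ℝ) 1 ×ˢ Metric.closedBall z 1) :=
      isCompact_Icc.prod (isCompact_closedBall z 1)
    obtain ⟨C, hC⟩ := hK.exists_bound_of_continuousOn hp'.continuous.continuousOn
    have hc : ∀ y, Continuous fun s : ℝ => p (s, y) := fun y =>
      hp.continuous.comp (by fun_prop)
    refine intervalIntegral.hasFDerivAt_integral_of_dominated_of_fderiv_le
      (F := fun z s => p (s, z)) (F' := fun z s => p' (s, z)) (bound := fun _ => C)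
      (Metric.ball_mem_nhds z one_pos)
      (Eventually.of_forall fun y => (hc y).aestronglyMeasurable)
      ((hc z).intervalIntegrable 0 1)
      (hp'.continuous.comp (by fun_prop : Continuous fun s : ℝ => (s, z))).aestronglyMeasurable
      (Eventually.of_forall fun s hs y hy => hC _ ⟨?_, Metric.ball_subset_closedBall hy⟩)
      (by simp) (Eventually.of_forall fun s _ y _ => ?_)
    · rw [uIoc_of_le zero_le_one] at hs
      exact ⟨hs.1.le, hs.2⟩
    · exact (hp.differentiable (by simp) (s, y)).hasFDerivAt.comp y (hasFDerivAt_prodMk_right s y)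

/-- Division by a linear form. -/
theorem exists_eq_mul_of_vanishing_on_ker {E : Type} [NormedAddCommGroup E] [NormedSpace ℝ E]
    [FiniteDimensional ℝ E] {q : E → ℝ} (hq : ContDiff ℝ ∞ q) {ℓ : E →L[ℝ] ℝ} (hℓ : ℓ ≠ 0)
    (h0 : ∀ z, ℓ z = 0 → q z = 0) : ∃ g : E → ℝ, ContDiff ℝ ∞ g ∧ ∀ z, q z = g z * ℓ z := by
  obtain ⟨w, hw⟩ : ∃ w, ℓ w ≠ 0 := by
    by_contra! h
    exact hℓ (ContinuousLinearMap.ext h)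
  set v := (ℓ w)⁻¹ • w
  have hv : ℓ v = 1 := by simp [v, hw]
  let a : ℝ × E → E := fun y => y.2 - ((1 - y.1) * ℓ y.2) • v
  have ha : ContDiff ℝ ∞ a := by fun_prop
  have hp : ContDiff ℝ ∞ fun y : ℝ × E => fderiv ℝ q (a y) v :=
    ((hq.fderiv_right (m := ∞) (by simp)).comp ha).clm_apply contDiff_const
  refine ⟨_, contDiff_intervalIntegral_param hp, fun z => ?_⟩
  have hd : ∀ s ∈ uIcc (0 : ℝ) 1, HasDerivAt (fun s : ℝ => q (a (s, z)))
      (fderiv ℝ q (a (s, z)) v * ℓ z) s := by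
    intro s _
    have h1 : HasDerivAt (fun s : ℝ => a (s, z)) (ℓ z • v) s := by
      have : HasDerivAt (fun s : ℝ => z - ((1 - s) * ℓ z) • v) (-((-1 * ℓ z) • v)) s :=
        ((((hasDerivAt_id s).const_sub 1).mul_const (ℓ z)).smul_const v).const_sub z
      simpa using this
    refine ((hq.differentiable (by simp) (a (s, z))).hasFDerivAt.comp_hasDerivAt s
      h1).congr_deriv ?_
    simp [mul_comm]
  have hcont : Continuous fun s : ℝ => fderiv ℝ q (a (s, z)) v * ℓ z :=
    (hp.continuous.comp (by fun_prop : Continuous fun s : ℝ => (s, z))).mul continuous_const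
  have := intervalIntegral.integral_eq_sub_of_hasDerivAt hd (hcont.intervalIntegrable 0 1)
  rw [intervalIntegral.integral_mul_const] at this
  rw [this]
  simp [a, h0 (z - ℓ z • v) (by simp [hv])]

theorem exists_contDiff_eventually_eq_one {E : Type*} [NormedAddCommGroup E] [NormedSpace ℝ E]
    [FiniteDimensional ℝ E] {s : Set E} {x : E} (hs : s ∈ 𝓝 x) :
    ∃ χ : E → ℝ, ContDiff ℝ ∞ χ ∧ HasCompactSupport χ ∧ tsupport χ ⊆ s ∧ ∀ᶠ y in 𝓝 x, χ y = 1 := by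
  obtain ⟨ε, hε, hs⟩ := Metric.nhds_basis_closedBall.mem_iff.1 hs
  let b : ContDiffBump x := ⟨ε / 2, ε, by positivity, by linarith⟩
  exact ⟨b, b.contDiff, b.hasCompactSupport, b.tsupport_eq.trans_subset hs, b.eventuallyEq_one⟩

theorem contDiff_mul_of_tsupport_subset {E : Type*} [NormedAddCommGroup E] [NormedSpace ℝ E]
    {A : Set E} (hA : IsOpen A) {f χ : E → ℝ} (hf : ContDiffOn ℝ ∞ f A) (hχ : ContDiff ℝ ∞ χ)
    (h : tsupport χ ⊆ A) : ContDiff ℝ ∞ fun x => χ x * f x := by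
  rw [contDiff_iff_contDiffAt]
  intro x
  by_cases hx : x ∈ A
  · exact hχ.contDiffAt.mul (hf.contDiffAt (hA.mem_nhds hx))
  · have h0 : (fun x => χ x * f x) =ᶠ[𝓝 x] fun _ => 0 := by
      filter_upwards [notMem_tsupport_iff_eventuallyEq.1 fun h' => hx (h h')] with y hy
      simp [hy]
    exact contDiffAt_const.congr_of_eventuallyEq h0

theorem exists_openPartialHomeomorph_contDiffOn_symm {E : Type*} [NormedAddCommGroup E]
    [NormedSpace ℝ E] [CompleteSpace E] {f : E → E} {A : Set E} (hA : IsOpen A)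
    (hf : ContDiffOn ℝ ∞ f A) {x : E} (hx : x ∈ A) {f' : E ≃L[ℝ] E}
    (hf' : HasFDerivAt f (f' : E →L[ℝ] E) x) :
    ∃ e : OpenPartialHomeomorph E E, x ∈ e.source ∧ e.source ⊆ A ∧ (∀ y, e y = f y) ∧
      ContDiffOn ℝ ∞ e.symm e.target := by
  have hfx := hf.contDiffAt (hA.mem_nhds hx)
  have hcont : ContinuousOn (fderiv ℝ f) A := hf.continuousOn_fderiv_of_isOpen hA (by simp)
  -- Smoothness of the inverse at a point needs an invertible derivative at its preimage, so the
  -- chart is shrunk to the open set where this holds.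
  have hB : IsOpen (A ∩ fderiv ℝ f ⁻¹' range ((↑) : (E ≃L[ℝ] E) → E →L[ℝ] E)) :=
    hcont.isOpen_inter_preimage hA ContinuousLinearEquiv.isOpen
  let e₀ := hfx.toOpenPartialHomeomorph f hf' (by simp)
  let e := e₀.restrOpen _ hB
  refine ⟨e, ⟨hfx.mem_toOpenPartialHomeomorph_source hf' (by simp), hx, f', hf'.fderiv.symm⟩,
    fun y hy => hy.2.1, fun y => rfl, fun z hz => ?_⟩
  have hs : e.symm z ∈ e.source := e.map_target hz
  obtain ⟨g', hg'⟩ := hs.2.2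
  have hsm := hf.contDiffAt (hA.mem_nhds hs.2.1)
  refine (e.contDiffAt_symm (f₀' := g') hz ?_ hsm).contDiffWithinAt
  rw [hg']
  exact (hsm.differentiableAt (by simp)).hasFDerivAt

/-- Division by a function with nonvanishing value or differential. -/
theorem exists_eventually_eq_mul {E : Type} [NormedAddCommGroup E] [NormedSpace ℝ E]
    [FiniteDimensional ℝ E] {A : Set E} (hA : IsOpen A) {P Q : E → ℝ} (hP : ContDiffOn ℝ ∞ P A)
    (hQ : ContDiffOn ℝ ∞ Q A) (h0 : ∀ y ∈ A, P y = 0 → Q y = 0) {i : E} (hi : i ∈ A)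
    (h : P i ≠ 0 ∨ fderiv ℝ P i ≠ 0) :
    ∃ g : E → ℝ, ContDiffAt ℝ ∞ g i ∧ ∀ᶠ y in 𝓝 i, Q y = g y * P y := by
  have hPi := hP.contDiffAt (hA.mem_nhds hi)
  by_cases hi0 : P i = 0
  swap
  · refine ⟨fun y => Q y / P y, (hQ.contDiffAt (hA.mem_nhds hi)).div hPi hi0, ?_⟩
    filter_upwards [hPi.continuousAt.eventually_ne hi0] with y hy
    field_simp
  have hd : fderiv ℝ P i ≠ 0 := h.resolve_left (by simpa using hi0)
  set ℓ := fderiv ℝ P i with hℓ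
  obtain ⟨w, hw⟩ : ∃ w, ℓ w ≠ 0 := by
    by_contra! h
    exact hd (ContinuousLinearMap.ext h)
  set v := (ℓ w)⁻¹ • w
  have hv : ℓ v = 1 := by simp [v, hw]
  -- A change of coordinates with `ℓ ∘ Φ = P` and derivative the identity at `i`: `P` becomes the
  -- linear form `ℓ`.
  let Φ : E → E := fun y => y + (P y - ℓ y) • v
  have hℓΦ : ∀ y, ℓ (Φ y) = P y := fun y => by simp [Φ, hv]
  have hΦ : ContDiffOn ℝ ∞ Φ A :=
    contDiffOn_id.add ((hP.sub ℓ.contDiff.contDiffOn).smul contDiffOn_const)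
  have hΦ' : HasFDerivAt Φ ((ContinuousLinearEquiv.refl ℝ E : E ≃L[ℝ] E) : E →L[ℝ] E) i := by
    have := (hasFDerivAt_id (𝕜 := ℝ) i).add
      (((hPi.differentiableAt (by simp)).hasFDerivAt.sub ℓ.hasFDerivAt).smul_const v)
    refine this.congr_fderiv ?_
    ext y
    simp [ℓ]
  obtain ⟨e, hie, heA, he, hsymm⟩ := exists_openPartialHomeomorph_contDiffOn_symm hA hΦ hi hΦ'
  -- Division by a linear form is available for globally defined functions, so `Q ∘ e.symm` is cut
  -- off inside the chart.
  obtain ⟨χ, hχ, -, hχs, hχ1⟩ := exists_contDiff_eventually_eq_one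
    (e.open_target.mem_nhds (e.map_source hie))
  have hq := contDiff_mul_of_tsupport_subset (f := fun z => Q (e.symm z)) e.open_target
    (hQ.comp hsymm fun z hz => heA (e.map_target hz)) hχ hχs
  obtain ⟨g, hg, hgq⟩ := exists_eq_mul_of_vanishing_on_ker hq hd fun z hz => by
    by_cases hzt : z ∈ e.target
    · rw [h0 _ (heA (e.map_target hzt)), mul_zero]
      rw [← hℓΦ, ← he, e.right_inv hzt, hz]
    · rw [image_eq_zero_of_notMem_tsupport fun h' => hzt (hχs h'), zero_mul]
  have hΦi := hΦ.contDiffAt (hA.mem_nhds hi)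
  refine ⟨fun y => g (Φ y), hg.contDiffAt.comp i hΦi, ?_⟩
  rw [he] at hχ1
  filter_upwards [hΦi.continuousAt.eventually hχ1, e.open_source.mem_nhds hie] with y hy hys
  rw [← hℓΦ, ← hgq, hy, one_mul, ← he, e.left_inv hys]

end ScalarJet

/-! ### Functions affine along a spanning quadratic family of directions -/

namespace ScalarJet

open Set Filter Topology

section Fibre

variable {E V : Type*} [NormedAddCommGroup V] [NormedSpace ℝ V]

/-- `P` is affine along every line with a direction in the range of `K`. -/
def AffineAlong (K : E → V) (P : V → ℝ) : Prop :=
  ∀ a k, ∃ b : ℝ, ∀ t : ℝ, P (a + t • K k) = P a + t * b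

variable {K : E → V} {P Q : V → ℝ}

theorem AffineAlong.sub_const_mul (hQ : AffineAlong K Q) (hP : AffineAlong K P) (c : ℝ) :
    AffineAlong K fun a => Q a - c * P a := by
  intro a k
  obtain ⟨b, hb⟩ := hP a k
  obtain ⟨b', hb'⟩ := hQ a k
  exact ⟨b' - c * b, fun t => by beta_reduce; rw [hb, hb']; ring⟩

theorem AffineAlong.eq_add_fderiv (hP : AffineAlong K P) (hd : Differentiable ℝ P) (a : V) (k : E)
    (t : ℝ) : P (a + t • K k) = P a + t * fderiv ℝ P a (K k) := by
  obtain ⟨b, hb⟩ := hP a k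
  have h1 : HasLineDerivAt ℝ P b a (K k) := by
    unfold HasLineDerivAt
    simp only [hb]
    simpa using ((hasDerivAt_id (0 : ℝ)).mul_const b).const_add (P a)
  rw [hb, ← (hd a).lineDeriv_eq_fderiv, h1.lineDeriv]

/-- Differentiate `P (a + t • K m) = P a + t * fderiv ℝ P a (K m)` with respect to `a` in the
direction `K k`. -/
theorem AffineAlong.fderiv_apply (hP : AffineAlong K P) (hd : ContDiff ℝ ∞ P) (k : E) :
    AffineAlong K fun a => fderiv ℝ P a (K k) := by
  intro a m
  have hdiff : Differentiable ℝ P := hd.differentiable (by simp)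
  have hd2 : Differentiable ℝ fun a => fderiv ℝ P a (K m) :=
    ((hd.fderiv_right (m := ∞) (by simp)).clm_apply contDiff_const).differentiable (by simp)
  refine ⟨fderiv ℝ (fun a => fderiv ℝ P a (K m)) a (K k), fun t => ?_⟩
  have he : (fun a => P (a + t • K m)) = fun a => P a + t * fderiv ℝ P a (K m) :=
    funext fun a => hP.eq_add_fderiv hdiff a m t
  have := congrArg (fun f => fderiv ℝ f a (K k)) he
  simp only [fderiv_comp_add_right] at this
  beta_reduce
  rw [this, fderiv_fun_add (hdiff a) ((hd2 a).const_mul t), fderiv_const_mul (hd2 a)]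
  rfl

/-- Unique continuation. An affine function on a line that vanishes near one of its points vanishes
on the line, so an open set of zeros can be translated along each `K k`. Such translations compose
to every translation, since the `K k` span. -/
theorem AffineAlong.eq_zero_of_eventually (hspan : Submodule.span ℝ (range K) = ⊤)
    (hP : AffineAlong K P) {a : V} (ha : ∀ᶠ y in 𝓝 a, P y = 0) (y : V) : P y = 0 := by
  have key : ∀ v : V, ∀ (c : ℝ) (a : V), (∀ᶠ y in 𝓝 a, P y = 0) →
      ∀ᶠ y in 𝓝 (a + c • v), P y = 0 := by
    intro v
    have hv : v ∈ Submodule.span ℝ (range K) := hspan ▸ Submodule.mem_top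
    induction hv using Submodule.span_induction with
    | mem v hv =>
      obtain ⟨k, rfl⟩ := hv
      intro c a ha
      have hc : Tendsto (fun y => y - c • K k) (𝓝 (a + c • K k)) (𝓝 a) :=
        (continuous_id.sub continuous_const).tendsto' _ _ (by simp)
      filter_upwards [hc.eventually ha.eventually_nhds] with y hy
      obtain ⟨b, hb⟩ := hP (y - c • K k) k
      have h0 : P (y - c • K k) = 0 := hy.self_of_nhds
      have ht : Tendsto (fun t : ℝ => y - c • K k + t • K k) (𝓝[≠] 0) (𝓝 (y - c • K k)) :=
        ((by fun_prop : Continuous fun t : ℝ => y - c • K k + t • K k).tendsto' 0 _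
          (by simp)).mono_left nhdsWithin_le_nhds
      obtain ⟨t, ht, ht0⟩ := ((ht.eventually hy).and self_mem_nhdsWithin).exists
      rw [hb, h0, zero_add] at ht
      have hb0 : b = 0 := (mul_eq_zero.1 ht).resolve_left ht0
      have := hb c
      rwa [sub_add_cancel, h0, hb0, mul_zero, add_zero] at this
    | zero => intro c a ha; simpa using ha
    | add v w _ _ hv hw =>
      intro c a ha
      rw [smul_add, ← add_assoc]
      exact hw c _ (hv c a ha)
    | smul r v _ hv =>
      intro c a ha
      rw [smul_smul]
      exact hv _ a ha
  simpa using (key (y - a) 1 a ha).self_of_nhds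

theorem fderiv_eq_zero_of_span (hspan : Submodule.span ℝ (range K) = ⊤) {L : V →L[ℝ] ℝ}
    (h : ∀ k, L (K k) = 0) : L = 0 := by
  ext v
  have hv : v ∈ Submodule.span ℝ (range K) := hspan ▸ Submodule.mem_top
  induction hv using Submodule.span_induction with
  | mem v hv => obtain ⟨k, rfl⟩ := hv; exact h k
  | zero => simp
  | add v w _ _ hv hw => rw [map_add, hv, hw]; simp
  | smul r v _ hv => rw [map_smul, hv]; simp

/-- A nonzero slope along some `K k` would produce a zero on that line. -/
theorem AffineAlong.fderiv_eq_zero_of_forall_ne (hspan : Submodule.span ℝ (range K) = ⊤)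
    (hP : AffineAlong K P) (hd : Differentiable ℝ P) (h : ∀ a, P a ≠ 0) (a : V) :
    fderiv ℝ P a = 0 := by
  refine fderiv_eq_zero_of_span hspan fun k => ?_
  by_contra hk
  refine h (a + (-(P a / fderiv ℝ P a (K k))) • K k) ?_
  rw [hP.eq_add_fderiv hd]
  field_simp
  ring

/-- If two functions are affine along all directions `K k` and the zeros of the first one are zeros
of the second one, then the second one is a constant multiple of the first one. -/
theorem AffineAlong.exists_eq_const_mul [NormedAddCommGroup E] [NormedSpace ℝ E]
    (hspan : Submodule.span ℝ (range K) = ⊤)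
    (hquad : ∃ B : E → E → V, ∀ k m (t : ℝ), K (k + t • m) = K k + t • B k m + t ^ 2 • K m)
    (hP : AffineAlong K P) (hQ : AffineAlong K Q) (hdP : ContDiff ℝ ∞ P) (hdQ : ContDiff ℝ ∞ Q)
    (hPQ : ∀ a, P a = 0 → Q a = 0) (hQP : (∃ a, P a = 0) ∨ ∀ a, Q a = 0 → P a = 0) :
    ∃ c : ℝ, ∀ a, Q a = c * P a := by
  have dP : Differentiable ℝ P := hdP.differentiable (by simp)
  have dQ : Differentiable ℝ Q := hdQ.differentiable (by simp)
  have cP : ∀ k, Continuous fun a => fderiv ℝ P a (K k) := fun k =>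
    ((hdP.fderiv_right (m := ∞) (by simp)).clm_apply contDiff_const).continuous
  have cQ : ∀ k, Continuous fun a => fderiv ℝ Q a (K k) := fun k =>
    ((hdQ.fderiv_right (m := ∞) (by simp)).clm_apply contDiff_const).continuous
  by_cases hne : ∃ a, P a ≠ 0
  swap
  · push Not at hne
    exact ⟨0, fun a => by rw [hPQ a (hne a), zero_mul]⟩
  obtain ⟨a₀, ha₀⟩ := hne
  by_cases hgrad : ∃ a k, fderiv ℝ P a (K k) ≠ 0
  swap
  · push Not at hgrad
    -- `P` is a nonzero constant. Only here is `hQP` needed: it makes `Q` zero-free, hence constant.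
    have hconst : ∀ a, P a = P a₀ := fun a => is_const_of_fderiv_eq_zero dP
      (fun a => fderiv_eq_zero_of_span hspan (hgrad a)) a a₀
    have hne : ∀ a, P a ≠ 0 := fun a => by rwa [hconst]
    have hQne : ∀ a, Q a ≠ 0 := fun a ha => by
      rcases hQP with ⟨b, hb⟩ | hQP
      · exact hne b hb
      · exact hne a (hQP a ha)
    have hconstQ : ∀ a, Q a = Q a₀ := fun a => is_const_of_fderiv_eq_zero dQ
      (hQ.fderiv_eq_zero_of_forall_ne hspan dQ hQne) a a₀
    exact ⟨Q a₀ / P a₀, fun a => by rw [hconst a, hconstQ a]; field_simp⟩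
  obtain ⟨a₁, k₁, h₁⟩ := hgrad
  -- the identity `Q dP = P dQ` in the directions along which `P` is not constant
  have h_generic : ∀ k, (∃ b, fderiv ℝ P b (K k) ≠ 0) → ∀ a,
      Q a * fderiv ℝ P a (K k) = P a * fderiv ℝ Q a (K k) := by
    rintro k ⟨b, hb⟩ a
    have hclosed : IsClosed {a | Q a * fderiv ℝ P a (K k) = P a * fderiv ℝ Q a (K k)} :=
      isClosed_eq (dQ.continuous.mul (cP k)) (dP.continuous.mul (cQ k))
    refine closure_minimal (s := {a | fderiv ℝ P a (K k) ≠ 0}) ?_ hclosed ?_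
    · intro a ha
      -- The line through `a` in the direction `K k` meets the zero set of `P` at this parameter;
      -- `Q` vanishes there too.
      have hz := hPQ (a + (-(P a / fderiv ℝ P a (K k))) • K k) (by
        rw [hP.eq_add_fderiv dP]
        have : fderiv ℝ P a (K k) ≠ 0 := ha
        field_simp
        ring)
      rw [hQ.eq_add_fderiv dQ] at hz
      have ha' : fderiv ℝ P a (K k) ≠ 0 := ha
      field_simp at hz
      change _ = _
      linarith
    · rw [mem_closure_iff_frequently]
      intro hn
      -- The slope is itself affine along the family, so it cannot vanish on an open set without
      -- vanishing identically.
      refine hb ((hP.fderiv_apply hdP k).eq_zero_of_eventually hspan (a := a) ?_ b)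
      filter_upwards [hn] with y hy
      simpa using hy
  have h_all : ∀ k a, Q a * fderiv ℝ P a (K k) = P a * fderiv ℝ Q a (K k) := by
    intro k a
    obtain ⟨B, hB⟩ := hquad
    have hline : Continuous fun t : ℝ => K (k + t • k₁) := by
      simp only [hB]; fun_prop
    have hclosed : IsClosed {t : ℝ | Q a * fderiv ℝ P a (K (k + t • k₁)) =
        P a * fderiv ℝ Q a (K (k + t • k₁))} :=
      isClosed_eq (continuous_const.mul ((fderiv ℝ P a).continuous.comp hline))
        (continuous_const.mul ((fderiv ℝ Q a).continuous.comp hline))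
    -- For arbitrary `k`, perturb to `k + t • k₁`. The slope of `P` at `a₁` is then a quadratic
    -- polynomial in `t` with leading coefficient `fderiv ℝ P a₁ (K k₁) ≠ 0`, so it is nonzero for
    -- values of `t` accumulating at `0`.
    have h0 : (0 : ℝ) ∈ closure {t : ℝ | fderiv ℝ P a₁ (K (k + t • k₁)) ≠ 0} := by
      rw [mem_closure_iff_frequently]
      intro hn
      have hn' : ∀ᶠ t in 𝓝 (0 : ℝ), ((Polynomial.C (fderiv ℝ P a₁ (K k)) +
          Polynomial.X * Polynomial.C (fderiv ℝ P a₁ (B k k₁)) +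
          Polynomial.X ^ 2 * Polynomial.C (fderiv ℝ P a₁ (K k₁)) : Polynomial ℝ)).IsRoot t := by
        filter_upwards [hn] with t ht
        have : fderiv ℝ P a₁ (K (k + t • k₁)) = 0 := by simpa using ht
        rw [hB] at this
        simp only [Polynomial.IsRoot, Polynomial.eval_add, Polynomial.eval_mul, Polynomial.eval_C,
          Polynomial.eval_X, Polynomial.eval_pow]
        simpa using this
      have hinf : {t : ℝ | ((Polynomial.C (fderiv ℝ P a₁ (K k)) +
          Polynomial.X * Polynomial.C (fderiv ℝ P a₁ (B k k₁)) +
          Polynomial.X ^ 2 * Polynomial.C (fderiv ℝ P a₁ (K k₁)) :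
            Polynomial ℝ)).IsRoot t}.Infinite :=
        infinite_of_mem_nhds 0 hn'
      have hp0 := Polynomial.eq_zero_of_infinite_isRoot _ hinf
      have := congrArg (fun p => Polynomial.coeff p 2) hp0
      simp at this
      exact h₁ this
    have := closure_minimal (s := {t : ℝ | fderiv ℝ P a₁ (K (k + t • k₁)) ≠ 0})
      (fun t ht => h_generic _ ⟨a₁, ht⟩ a) hclosed h0
    change Q a * fderiv ℝ P a (K (k + (0 : ℝ) • k₁)) =
      P a * fderiv ℝ Q a (K (k + (0 : ℝ) • k₁)) at this
    simpa using this
  have hder : ∀ a, Q a • fderiv ℝ P a = P a • fderiv ℝ Q a := fun a => by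
    rw [← sub_eq_zero]
    refine fderiv_eq_zero_of_span hspan fun k => ?_
    simpa [sub_eq_zero] using h_all k a
  refine ⟨Q a₀ / P a₀, fun a => ?_⟩
  -- `Q dP = P dQ` makes `Q / P` constant near `a₀`; unique continuation for `Q - c P` carries the
  -- proportionality to the whole space.
  obtain ⟨ε, hε, hball⟩ := Metric.eventually_nhds_iff_ball.1
    (dP.continuous.continuousAt.eventually_ne ha₀)
  have hz : ∀ y ∈ Metric.ball a₀ ε, Q y / P y = Q a₀ / P a₀ := by
    intro y hy
    have hd : ∀ z ∈ Metric.ball a₀ ε, HasFDerivAt (fun z => Q z / P z) (0 : V →L[ℝ] ℝ) z := by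
      intro z hz
      have hPz := hball z hz
      simp only [div_eq_mul_inv]
      refine ((dQ z).hasFDerivAt.mul
        ((hasDerivAt_inv hPz).comp_hasFDerivAt z (dP z).hasFDerivAt)).congr_fderiv ?_
      ext w
      have := congrArg (fun L : V →L[ℝ] ℝ => L w) (hder z)
      simp only [smul_apply, smul_eq_mul] at this
      simp
      field_simp
      linarith
    exact (convex_ball a₀ ε).is_const_of_fderivWithin_eq_zero (𝕜 := ℝ)
      (fun z hz => (hd z hz).differentiableAt.differentiableWithinAt)
      (fun z hz => by
        rw [fderivWithin_of_isOpen Metric.isOpen_ball hz, (hd z hz).fderiv]) hy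
      (Metric.mem_ball_self hε)
  have := (hQ.sub_const_mul hP (Q a₀ / P a₀)).eq_zero_of_eventually hspan (a := a₀) (by
    filter_upwards [Metric.ball_mem_nhds a₀ hε] with y hy
    rw [← hz y hy]
    have := hball y hy
    field_simp
    ring) a
  linarith

end Fibre

end ScalarJet

/-! ### Integration by parts and the first variation -/

namespace ScalarJet

open Set Filter Topology

open MeasureTheory

variable {n : ℕ}

theorem prod_factorial_count_erase {s : Multiset (Fin n)} {a : Fin n} (ha : a ∈ s) :
    ∏ ν, (s.count ν).factorial = s.count a * ∏ ν, ((s.erase a).count ν).factorial := by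
  rw [← Finset.mul_prod_erase _ _ (Finset.mem_univ a),
    ← Finset.mul_prod_erase Finset.univ (fun ν => ((s.erase a).count ν).factorial)
      (Finset.mem_univ a), ← mul_assoc]
  congr 1
  · obtain ⟨c, hc⟩ := Nat.exists_eq_succ_of_ne_zero (Multiset.count_pos.2 ha).ne'
    rw [Multiset.count_erase_self, hc]
    rfl
  · refine Finset.prod_congr rfl fun ν hν => ?_
    rw [Multiset.count_erase_of_ne (Finset.ne_of_mem_erase hν)]

/-- The number of sequences with a given underlying multiset. -/
theorem card_sequences_mul (l : ℕ) (s : Multiset (Fin n)) (hs : s.card = l) :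
    (∑ μ : Fin l → Fin n, if Finset.univ.val.map μ = s then 1 else 0) *
      ∏ ν, (s.count ν).factorial = l.factorial := by
  induction l generalizing s with
  | zero =>
    rw [Multiset.card_eq_zero] at hs
    subst hs
    simp
  | succ l ih =>
    have hmap : ∀ (a : Fin n) (μ : Fin l → Fin n),
        (Finset.univ.val.map (Fin.cons a μ : Fin (l + 1) → Fin n) : Multiset (Fin n)) =
          a ::ₘ Finset.univ.val.map μ := by
      intro a μ
      rw [Fin.univ_val_map, Fin.univ_val_map, List.ofFn_cons, Multiset.cons_coe]
    rw [← (Fin.consEquiv fun _ => Fin n).sum_comp, Fintype.sum_prod_type, Finset.sum_mul]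
    simp only [Fin.consEquiv_apply, hmap]
    -- Classify sequences by their first entry `a`: the remaining entries enumerate `s.erase a`, and
    -- the multiplicities of `s` add up to `l + 1`.
    calc _ = ∑ a : Fin n, s.count a * l.factorial := by
          refine Finset.sum_congr rfl fun a _ => ?_
          by_cases ha : a ∈ s
          · have hs' : (s.erase a).card = l := by
              rw [Multiset.card_erase_of_mem ha, hs]; rfl
            have hiff : ∀ μ : Fin l → Fin n, a ::ₘ Finset.univ.val.map μ = s ↔
                Finset.univ.val.map μ = s.erase a := by
              intro μ
              constructor
              · rintro rfl; simp
              · intro h; rw [h, Multiset.cons_erase ha]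
            simp only [hiff]
            rw [prod_factorial_count_erase ha, ← ih _ hs']
            ring
          · have hne : ∀ μ : Fin l → Fin n, ¬ a ::ₘ Finset.univ.val.map μ = s := by
              rintro μ rfl
              exact ha (Multiset.mem_cons_self _ _)
            simp only [hne, if_false, Finset.sum_const_zero, zero_mul, Multiset.count_eq_zero.2 ha]
      _ = (l + 1).factorial := by
          rw [← Finset.sum_mul, Multiset.sum_count_eq_card fun a _ => Finset.mem_univ a, hs]
          rfl

/-- The weight `r₁! ⋯ r_n! / l!` is the reciprocal of the number of sequences with a given multiset,
so summing over sequences counts every unordered multi-index once. This is the purpose of the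
normalization in `dUp`. -/
theorem sum_sequences {r : ℕ} (g : MIdx n r → ℝ) :
    ∑ l : Fin (r + 1), ∑ μ : Fin (l : ℕ) → Fin n,
      ((∏ ν : Fin n, ((midx (Nat.le_of_lt_succ l.2) μ).1.count ν).factorial : ℕ) : ℝ) /
        ((l : ℕ).factorial : ℝ) * g (midx (Nat.le_of_lt_succ l.2) μ) = ∑ s, g s := by
  classical
  have h1 : ∀ l : Fin (r + 1), ∑ μ : Fin (l : ℕ) → Fin n,
      ((∏ ν : Fin n, ((midx (Nat.le_of_lt_succ l.2) μ).1.count ν).factorial : ℕ) : ℝ) /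
        ((l : ℕ).factorial : ℝ) * g (midx (Nat.le_of_lt_succ l.2) μ) =
      ∑ s : MIdx n r, if s.1.card = l then g s else 0 := by
    intro l
    rw [← Finset.sum_fiberwise (g := midx (Nat.le_of_lt_succ l.2))]
    refine Finset.sum_congr rfl fun s _ => ?_
    rw [Finset.sum_congr rfl (g := fun _ =>
      ((∏ ν : Fin n, (s.1.count ν).factorial : ℕ) : ℝ) / ((l : ℕ).factorial : ℝ) * g s)
      (fun μ hμ => by rw [(Finset.mem_filter.1 hμ).2])]
    rw [Finset.sum_const, Finset.card_filter, nsmul_eq_mul]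
    have hiff : ∀ μ : Fin (l : ℕ) → Fin n, midx (Nat.le_of_lt_succ l.2) μ = s ↔
        Finset.univ.val.map μ = s.1 := fun μ => Subtype.ext_iff
    simp only [hiff]
    split_ifs with h
    · have := card_sequences_mul _ s.1 h
      have hl : ((l : ℕ).factorial : ℝ) ≠ 0 := by positivity
      rw [← mul_assoc, mul_div_assoc', ← Nat.cast_mul, this, div_self hl, one_mul]
    · have hne : ∀ μ : Fin (l : ℕ) → Fin n, ¬ Finset.univ.val.map μ = s.1 := by
        intro μ hμ
        apply h
        rw [← hμ]
        simp
      simp only [hne, if_false, Finset.sum_const_zero, Nat.cast_zero, zero_mul]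
  simp only [h1]
  rw [Finset.sum_comm]
  refine Finset.sum_congr rfl fun s _ => ?_
  rw [Finset.sum_eq_single ⟨s.1.card, Nat.lt_succ_of_le s.2⟩]
  · simp
  · intro l _ hl
    rw [if_neg]
    intro h
    exact hl (Fin.ext h.symm)
  · simp

theorem contDiff_partials {u : (Fin n → ℝ) → ℝ} (hu : ContDiff ℝ ∞ u) (l : List (Fin n)) :
    ContDiff ℝ ∞ (partials u l) :=
  contDiffOn_univ.1 (contDiffOn_partials isOpen_univ hu.contDiffOn l)

theorem tsupport_partials_subset (u : (Fin n → ℝ) → ℝ) (l : List (Fin n)) :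
    tsupport (partials u l) ⊆ tsupport u := by
  induction l with
  | nil => exact subset_rfl
  | cons μ l ih => exact (tsupport_fderiv_apply_subset ℝ _).trans ih

theorem hasCompactSupport_partials {u : (Fin n → ℝ) → ℝ} (hu : HasCompactSupport u)
    (l : List (Fin n)) : HasCompactSupport (partials u l) :=
  hu.mono' ((subset_tsupport _).trans (tsupport_partials_subset u l))

theorem integrable_mul_of_tsupport_subset {B : Set (Fin n → ℝ)} (hB : IsOpen B)
    {η G : (Fin n → ℝ) → ℝ} (hη : ContDiff ℝ ∞ η) (hc : HasCompactSupport η)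
    (hs : tsupport η ⊆ B) (hG : ContDiffOn ℝ ∞ G B) : Integrable fun x => η x * G x :=
  (contDiff_mul_of_tsupport_subset hB hG hη hs).continuous.integrable_of_hasCompactSupport
    hc.mul_right

/-- One integration by parts per index. Boundary terms are absent because `η` has compact support
inside the open set where `G` is smooth. -/
theorem integral_mul_partials {B : Set (Fin n → ℝ)} (hB : IsOpen B) {η G : (Fin n → ℝ) → ℝ}
    (hη : ContDiff ℝ ∞ η) (hc : HasCompactSupport η) (hs : tsupport η ⊆ B)
    (hG : ContDiffOn ℝ ∞ G B) (l : List (Fin n)) :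
    ∫ x, η x * partials G l x = (-1) ^ l.length * ∫ x, partials η l x * G x := by
  induction l generalizing η with
  | nil => simp [partials]
  | cons μ l ih =>
    have hη' : ContDiff ℝ ∞ (partials η [μ]) := contDiff_partials hη _
    have hc' : HasCompactSupport (partials η [μ]) := hasCompactSupport_partials hc _
    have hs' : tsupport (partials η [μ]) ⊆ B := (tsupport_partials_subset _ _).trans hs
    have hl := contDiffOn_partials hB hG l
    have h1 : ∫ x, η x * partials G (μ :: l) x = -∫ x, partials η [μ] x * partials G l x :=
      integral_mul_fderiv_eq_neg_fderiv_mul_of_integrable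
        (integrable_mul_of_tsupport_subset hB hη' hc' hs' hl)
        (integrable_mul_of_tsupport_subset hB hη hc hs (contDiffOn_partials hB hG (μ :: l)))
        (integrable_mul_of_tsupport_subset hB hη hc hs hl)
        (fun x _ => hη.differentiable (by simp) x)
        (fun x hx => (hl.contDiffAt (hB.mem_nhds (hs hx))).differentiableAt (by simp))
    rw [h1, ih hη' hc' hs', ← partials_append]
    have h2 : partials η (l ++ [μ]) = partials η (μ :: l) := funext fun x =>
      partials_perm isOpen_univ hη.contDiffOn (List.perm_append_singleton μ l) (mem_univ x)
    rw [h2, List.length_cons, pow_succ]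
    ring

theorem mk_zero_eq_sum {k : ℕ} (a : MIdx n k → ℝ) :
    ((0, a) : Jet n k) = ∑ s, a s • eU s := by
  refine Prod.ext ?_ ?_
  · simp [Prod.fst_sum, eU]
  · rw [Prod.snd_sum]
    ext t
    simp [eU, Finset.sum_apply, Pi.single_apply]

theorem apply_mk_zero {k : ℕ} (A : Jet n k →L[ℝ] ℝ) (a : MIdx n k → ℝ) :
    A (0, a) = ∑ s, A (eU s) * a s := by
  rw [mk_zero_eq_sum, map_sum]
  simp [mul_comm]

/-- The first variation formula. -/
theorem integral_mul_eulerLagrange {r : ℕ} {W : Set (Jet n r)} (hW : IsOpen W)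
    {L : Jet n r → ℝ} (hL : ContDiffOn ℝ ∞ L W) {B : Set (Fin n → ℝ)} (hB : IsOpen B)
    {u : (Fin n → ℝ) → ℝ} (hu : ContDiffOn ℝ ∞ u B) (hm : MapsTo (jet r u) B W)
    {η : (Fin n → ℝ) → ℝ} (hη : ContDiff ℝ ∞ η) (hc : HasCompactSupport η)
    (hs : tsupport η ⊆ B) :
    ∫ x, η x * eulerLagrange L (jet (r + r) u x) =
      ∫ x, fderiv ℝ L (jet r u x) (0, (jet r η x).2) := by
  have hdL : ∀ s : MIdx n r, ContDiffOn ℝ ∞ (fun i => fderiv ℝ L i (eU s)) W := fun s =>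
    (hL.fderiv_of_isOpen hW (by simp)).clm_apply contDiffOn_const
  have hd : ∀ {l : ℕ} (h : l ≤ r) (μ : Fin l → Fin n), ContDiffOn ℝ ∞ (dUp h μ L) W :=
    fun h μ => contDiffOn_const.mul (hdL _)
  have hdj : ∀ {l : ℕ} (h : l ≤ r) (μ : Fin l → Fin n),
      ContDiffOn ℝ ∞ (fun x => dUp h μ L (jet r u x)) B :=
    fun h μ => (hd h μ).comp (contDiffOn_jet hB hu r) hm
  have h1 : ∀ x, η x * eulerLagrange L (jet (r + r) u x) =
      ∑ l : Fin (r + 1), (-1 : ℝ) ^ (l : ℕ) * ∑ μ : Fin (l : ℕ) → Fin n,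
        η x * partials (fun x => dUp (Nat.le_of_lt_succ l.2) μ L (jet r u x))
          (List.ofFn μ).reverse x := by
    intro x
    by_cases hx : x ∈ B
    · unfold eulerLagrange
      rw [Finset.mul_sum]
      refine Finset.sum_congr rfl fun l _ => ?_
      rw [mul_left_comm, Finset.mul_sum]
      congr 1
      refine Finset.sum_congr rfl fun μ _ => ?_
      rw [trunc_jet, ← iterD_jet hB hu hW (hd _ μ) hm _ μ hx]
    · have : η x = 0 := image_eq_zero_of_notMem_tsupport fun h => hx (hs h)
      simp [this]
  have h2 : ∀ x, fderiv ℝ L (jet r u x) (0, (jet r η x).2) =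
      ∑ l : Fin (r + 1), ∑ μ : Fin (l : ℕ) → Fin n,
        partials η (List.ofFn μ).reverse x *
          dUp (Nat.le_of_lt_succ l.2) μ L (jet r u x) := by
    intro x
    rw [apply_mk_zero, ← sum_sequences]
    refine Finset.sum_congr rfl fun l _ => Finset.sum_congr rfl fun μ _ => ?_
    have : (jet r η x).2 (midx (Nat.le_of_lt_succ l.2) μ) =
        partials η (List.ofFn μ).reverse x := by
      refine partials_perm isOpen_univ hη.contDiffOn ?_ (mem_univ x)
      rw [← Multiset.coe_eq_coe]
      rw [Multiset.sort_eq]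
      simp [midx, Fin.univ_val_map]
    rw [this]
    simp only [dUp]
    ring
  simp only [h1, h2]
  have i1 : ∀ (l : Fin (r + 1)) (μ : Fin (l : ℕ) → Fin n), Integrable fun x =>
      η x * partials (fun x => dUp (Nat.le_of_lt_succ l.2) μ L (jet r u x))
          (List.ofFn μ).reverse x := fun l μ =>
    integrable_mul_of_tsupport_subset hB hη hc hs (contDiffOn_partials hB (hdj _ μ) _)
  have i2 : ∀ (l : Fin (r + 1)) (μ : Fin (l : ℕ) → Fin n), Integrable fun x =>
      partials η (List.ofFn μ).reverse x *
          dUp (Nat.le_of_lt_succ l.2) μ L (jet r u x) := fun l μ =>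
    integrable_mul_of_tsupport_subset hB (contDiff_partials hη _)
      (hasCompactSupport_partials hc _) ((tsupport_partials_subset _ _).trans hs) (hdj _ μ)
  rw [integral_finsetSum _ fun l _ =>
      (integrable_finsetSum _ fun μ _ => i1 l μ).const_mul _,
    integral_finsetSum _ fun l _ => integrable_finsetSum _ fun μ _ => i2 l μ]
  refine Finset.sum_congr rfl fun l _ => ?_
  rw [integral_const_mul, integral_finsetSum _ fun μ _ => i1 l μ,
    integral_finsetSum _ fun μ _ => i2 l μ, Finset.mul_sum]
  refine Finset.sum_congr rfl fun μ _ => ?_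
  -- The sign from `l` integrations by parts cancels the sign `(-1)^l` of the Euler–Lagrange
  -- expression.
  rw [integral_mul_partials hB hη hc hs (hdj _ μ), ← mul_assoc, List.length_reverse,
    List.length_ofFn, ← mul_pow]
  simp

end ScalarJet

/-! ### The second variation and formal self-adjointness -/

namespace ScalarJet

open Set Filter Topology

open MeasureTheory

variable {n : ℕ}

theorem integrable_of_continuousOn_of_eq_zero {B K : Set (Fin n → ℝ)}
    {f : (Fin n → ℝ) → ℝ} (hf : ContinuousOn f B) (hK : IsCompact K) (hKB : K ⊆ B)
    (h0 : ∀ x ∉ K, f x = 0) : Integrable f :=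
  ((hf.mono hKB).integrableOn_compact hK).integrable_of_forall_notMem_eq_zero h0

theorem hasDerivAt_fst {E : Type*} [NormedAddCommGroup E] [NormedSpace ℝ E] {F : ℝ × E → ℝ}
    {t : ℝ} {x : E} (h : DifferentiableAt ℝ F (t, x)) :
    HasDerivAt (fun t => F (t, x)) (fderiv ℝ F (t, x) (1, 0)) t :=
  h.hasFDerivAt.comp_hasDerivAt t ((hasDerivAt_id t).prodMk (hasDerivAt_const t x))

/-- The `t`-derivative vanishes off `K` and is bounded on `[-ε/2, ε/2] × K`, so a constant multiple
of the indicator of `K` dominates it. -/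
theorem hasDerivAt_integral_of_compact {F : ℝ × (Fin n → ℝ) → ℝ} {ε : ℝ} (hε : 0 < ε)
    (hF : ContDiffOn ℝ ∞ F (Ioo (-ε) ε ×ˢ univ)) {K : Set (Fin n → ℝ)} (hK : IsCompact K)
    (h0 : ∀ t, ∀ x ∉ K, F (t, x) = 0) :
    HasDerivAt (fun t => ∫ x, F (t, x)) (∫ x, fderiv ℝ F (0, x) (1, 0)) 0 := by
  have hO : IsOpen (Ioo (-ε) ε ×ˢ (univ : Set (Fin n → ℝ))) := isOpen_Ioo.prod isOpen_univ
  have hF' : ContinuousOn (fun w => fderiv ℝ F w (1, 0)) (Ioo (-ε) ε ×ˢ univ) :=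
    (hF.continuousOn_fderiv_of_isOpen hO (by simp)).clm_apply continuousOn_const
  have hderiv : ∀ t ∈ Ioo (-ε) ε, ∀ x,
      HasDerivAt (fun t => F (t, x)) (fderiv ℝ F (t, x) (1, 0)) t := by
    intro t ht x
    exact hasDerivAt_fst ((hF.contDiffAt (hO.mem_nhds (x := (t, x))
      ⟨ht, mem_univ x⟩)).differentiableAt (by simp))
  have h0' : ∀ t ∈ Ioo (-ε) ε, ∀ x ∉ K, fderiv ℝ F (t, x) (1, 0) = 0 := by
    intro t ht x hx
    refine (hderiv t ht x).unique ?_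
    simp only [h0 _ x hx]
    exact hasDerivAt_const _ _
  have hmk : ∀ t ∈ Ioo (-ε) ε, MapsTo (fun x : Fin n → ℝ => (t, x)) univ (Ioo (-ε) ε ×ˢ univ) :=
    fun t ht x _ => ⟨ht, mem_univ x⟩
  have hint : ∀ t ∈ Ioo (-ε) ε, Integrable fun x => F (t, x) := fun t ht =>
    integrable_of_continuousOn_of_eq_zero
      (hF.continuousOn.comp (by fun_prop) (hmk t ht)) hK (subset_univ K) (h0 t)
  have hzero : (0 : ℝ) ∈ Ioo (-ε) ε := by simp [hε]
  have hKK : IsCompact (Icc (-(ε / 2)) (ε / 2) ×ˢ K) := isCompact_Icc.prod hK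
  have hsub : Icc (-(ε / 2)) (ε / 2) ⊆ Ioo (-ε) ε := fun t ht =>
    ⟨by linarith [ht.1], by linarith [ht.2]⟩
  obtain ⟨C, hC⟩ := hKK.exists_bound_of_continuousOn (hF'.mono (prod_mono hsub (subset_univ K)))
  have hnhds : Icc (-(ε / 2)) (ε / 2) ∈ 𝓝 (0 : ℝ) := Icc_mem_nhds (by linarith) (by linarith)
  refine (hasDerivAt_integral_of_dominated_loc_of_deriv_le (F := fun t x => F (t, x))
    (F' := fun t x => fderiv ℝ F (t, x) (1, 0)) (bound := K.indicator fun _ => C) hnhds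
    ?_ (hint 0 hzero) ?_ ?_ ?_ ?_).2
  · filter_upwards [hnhds] with t ht
    exact (hint t (hsub ht)).aestronglyMeasurable
  · exact (integrable_of_continuousOn_of_eq_zero (hF'.comp (by fun_prop) (hmk 0 hzero)) hK
      (subset_univ K) (h0' 0 hzero)).aestronglyMeasurable
  · refine Eventually.of_forall fun x t ht => ?_
    by_cases hx : x ∈ K
    · rw [indicator_of_mem hx]
      exact hC (t, x) ⟨ht, hx⟩
    · rw [indicator_of_notMem hx, h0' t (hsub ht) x hx, norm_zero]
  · rw [integrable_indicator_iff hK.measurableSet]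
    exact integrableOn_const hK.measure_lt_top.ne
  · exact Eventually.of_forall fun x t ht => hderiv t (hsub ht) x

/-- The variation `(0, (∂_s ξ)_s)` of the `k`-jet of a section in the direction of `ξ`. -/
noncomputable def jetVar (k : ℕ) (ξ : (Fin n → ℝ) → ℝ) (x : Fin n → ℝ) : Jet n k :=
  (0, (jet k ξ x).2)

theorem partials_add_const_mul {u ξ : (Fin n → ℝ) → ℝ} (hu : ContDiff ℝ ∞ u)
    (hξ : ContDiff ℝ ∞ ξ) (t : ℝ) (l : List (Fin n)) :
    partials (fun x => u x + t * ξ x) l = fun x => partials u l x + t * partials ξ l x := by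
  have := partials_finset_sum (Finset.univ : Finset (Fin 2)) ![1, t] ![u, ξ]
    (by intro i; fin_cases i <;> simpa) l
  simpa [Fin.sum_univ_two] using this

theorem jet_add_const_mul {u ξ : (Fin n → ℝ) → ℝ} (hu : ContDiff ℝ ∞ u)
    (hξ : ContDiff ℝ ∞ ξ) (t : ℝ) (k : ℕ) (x : Fin n → ℝ) :
    jet k (fun x => u x + t * ξ x) x = jet k u x + t • jetVar k ξ x := by
  refine Prod.ext (by simp [jet, jetVar]) (funext fun s => ?_)
  simp [jet, jetVar, partials_add_const_mul hu hξ]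

theorem contDiff_jet {u : (Fin n → ℝ) → ℝ} (hu : ContDiff ℝ ∞ u) (k : ℕ) :
    ContDiff ℝ ∞ (jet k u) :=
  contDiffOn_univ.1 (contDiffOn_jet isOpen_univ hu.contDiffOn k)

theorem contDiff_jetVar {u : (Fin n → ℝ) → ℝ} (hu : ContDiff ℝ ∞ u) (k : ℕ) :
    ContDiff ℝ ∞ (jetVar k u) :=
  contDiff_const.prodMk (contDiff_jet hu k).snd

theorem jetVar_eq_zero {ξ : (Fin n → ℝ) → ℝ} {x : Fin n → ℝ} (hx : x ∉ tsupport ξ) (k : ℕ) :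
    jetVar k ξ x = 0 :=
  Prod.ext rfl (funext fun s =>
    image_eq_zero_of_notMem_tsupport (f := partials ξ (s.1.sort (· ≤ ·)))
      fun h => hx (tsupport_partials_subset _ _ h))

set_option maxHeartbeats 1000000 in
/-- The second variation formula. -/
theorem integral_mul_fderiv_eq_secondVariation {A : Set (Jet n 2)} (hA : IsOpen A) {T : Jet n 2 → ℝ}
    (hT : ContDiffOn ℝ ∞ T A) {r : ℕ} (hr : 2 ≤ r) {W : Set (Jet n r)} (hW : IsOpen W)
    (hWA : MapsTo (trunc 2 hr) W A) {L : Jet n r → ℝ} (hL : ContDiffOn ℝ ∞ L W)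
    (hTL : ∀ w : Jet n (r + r), trunc r (Nat.le_add_left r r) w ∈ W →
        T (trunc 2 (hr.trans (Nat.le_add_left r r)) w) = eulerLagrange L w)
    {u : (Fin n → ℝ) → ℝ} (hu : ContDiff ℝ ∞ u) {B : Set (Fin n → ℝ)} (hB : IsOpen B)
    (hm : MapsTo (jet r u) B W) {ξ η : (Fin n → ℝ) → ℝ} (hξ : ContDiff ℝ ∞ ξ)
    (hη : ContDiff ℝ ∞ η) (hcξ : HasCompactSupport ξ) (hcη : HasCompactSupport η)
    (hsξ : tsupport ξ ⊆ B) (hsη : tsupport η ⊆ B) :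
    ∫ x, η x * fderiv ℝ T (jet 2 u x) (jetVar 2 ξ x) =
      ∫ x, fderiv ℝ (fderiv ℝ L) (jet r u x) (jetVar r ξ x) (jetVar r η x) := by
  have hmA : MapsTo (jet 2 u) B A := fun x hx => hWA (hm hx)
  have hT' : ContDiffOn ℝ ∞ (fderiv ℝ T) A := hT.fderiv_of_isOpen hA (by simp)
  have hL' : ContDiffOn ℝ ∞ (fderiv ℝ L) W := hL.fderiv_of_isOpen hW (by simp)
  have hL'' : ContDiffOn ℝ ∞ (fderiv ℝ (fderiv ℝ L)) W := hL'.fderiv_of_isOpen hW (by simp)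
  -- Compactness of the support gives one range of `t` for which the varied jets stay in the domain
  -- `W` of the Lagrangian.
  have hev : ∀ᶠ t in 𝓝 (0 : ℝ), ∀ x ∈ tsupport ξ, jet r u x + t • jetVar r ξ x ∈ W := by
    refine hcξ.isCompact.eventually_forall_of_forall_eventually fun x hx => ?_
    have hc : Continuous fun z : ℝ × (Fin n → ℝ) => jet r u z.2 + z.1 • jetVar r ξ z.2 :=
      ((contDiff_jet hu r).continuous.comp continuous_snd).add
        (continuous_fst.smul ((contDiff_jetVar hξ r).continuous.comp continuous_snd))
    exact hc.continuousAt.eventually (hW.mem_nhds (by simpa using hm (hsξ hx)))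
  obtain ⟨ε, hε, hev⟩ := Metric.eventually_nhds_iff_ball.1 hev
  rw [Real.ball_eq_Ioo, zero_sub, zero_add] at hev
  have hmt : ∀ t ∈ Ioo (-ε) ε, ∀ x ∈ B, jet r u x + t • jetVar r ξ x ∈ W := by
    intro t ht x hx
    by_cases hxs : x ∈ tsupport ξ
    · exact hev t ht x hxs
    · simpa [jetVar_eq_zero hxs] using hm hx
  -- The difference of the two integrands in the first variation formula for `u + t ξ`. Its integral
  -- vanishes for all small `t`; the derivative of this identity at `t = 0` is the claim.
  let F : ℝ × (Fin n → ℝ) → ℝ := fun z =>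
    η z.2 * T (jet 2 u z.2 + z.1 • jetVar 2 ξ z.2) -
      fderiv ℝ L (jet r u z.2 + z.1 • jetVar r ξ z.2) (jetVar r η z.2)
  have hF0 : ∀ t, ∀ x ∉ tsupport η, F (t, x) = 0 := by
    intro t x hx
    simp [F, jetVar_eq_zero hx, image_eq_zero_of_notMem_tsupport hx]
  have hvar : ∀ {ζ : (Fin n → ℝ) → ℝ} (k : ℕ), ContDiff ℝ ∞ ζ →
      ContDiff ℝ ∞ fun z : ℝ × (Fin n → ℝ) => jet k u z.2 + z.1 • jetVar k ζ z.2 :=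
    fun k hζ => ((contDiff_jet hu k).comp contDiff_snd).add
      (contDiff_fst.smul ((contDiff_jetVar hζ k).comp contDiff_snd))
  have hvart : ∀ (t : ℝ) (k : ℕ), ContDiff ℝ ∞ fun x => jet k u x + t • jetVar k ξ x :=
    fun t k => (hvar k hξ).comp (contDiff_prodMk_right t)
  have hF : ContDiffOn ℝ ∞ F (Ioo (-ε) ε ×ˢ univ) := by
    rintro ⟨t, x⟩ ⟨ht, -⟩
    by_cases hx : x ∈ tsupport η
    · have hmem := hmt t ht x (hsη hx)
      refine ContDiffAt.contDiffWithinAt (ContDiffAt.sub (ContDiffAt.mul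
        (hη.comp contDiff_snd).contDiffAt ?_) (ContDiffAt.clm_apply ?_
        ((contDiff_jetVar hη r).comp contDiff_snd).contDiffAt))
      · exact ContDiffAt.comp (t, x) (hT.contDiffAt (hA.mem_nhds (hWA hmem)))
          (hvar 2 hξ).contDiffAt
      · exact ContDiffAt.comp (t, x) (hL'.contDiffAt (hW.mem_nhds hmem)) (hvar r hξ).contDiffAt
    · refine (contDiffAt_const (c := (0 : ℝ))).congr_of_eventuallyEq ?_ |>.contDiffWithinAt
      have : ∀ᶠ z : ℝ × (Fin n → ℝ) in 𝓝 (t, x), z.2 ∉ tsupport η :=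
        (continuous_snd.continuousAt (x := (t, x))).eventually
          ((isClosed_tsupport η).isOpen_compl.mem_nhds hx)
      filter_upwards [this] with z hz
      exact hF0 z.1 z.2 hz
  have hd := hasDerivAt_integral_of_compact hε hF hcη.isCompact hF0
  have hzero : (0 : ℝ) ∈ Ioo (-ε) ε := by simp [hε]
  have hint1 : ∀ t ∈ Ioo (-ε) ε,
      Integrable fun x => η x * T (jet 2 u x + t • jetVar 2 ξ x) := fun t ht =>
    integrable_mul_of_tsupport_subset hB hη hcη hsη (hT.comp
      (hvart t 2).contDiffOn
      fun x hx => hWA (hmt t ht x hx))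
  have hint2 : ∀ t ∈ Ioo (-ε) ε, Integrable fun x =>
      fderiv ℝ L (jet r u x + t • jetVar r ξ x) (jetVar r η x) := fun t ht =>
    integrable_of_continuousOn_of_eq_zero (ContDiffOn.continuousOn (𝕜 := ℝ) (n := ∞)
      ((hL'.comp (hvart t r).contDiffOn
      fun x hx => hmt t ht x hx).clm_apply (contDiff_jetVar hη r).contDiffOn))
      hcη.isCompact hsη fun x hx => by simp [jetVar_eq_zero hx]
  have hI : ∀ t ∈ Ioo (-ε) ε, ∫ x, F (t, x) = 0 := by
    intro t ht
    have hut : ContDiff ℝ ∞ fun x => u x + t * ξ x := hu.add (contDiff_const.mul hξ)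
    have hmut : MapsTo (jet r fun x => u x + t * ξ x) B W := fun x hx => by
      rw [jet_add_const_mul hu hξ]
      exact hmt t ht x hx
    have hEL := integral_mul_eulerLagrange hW hL hB hut.contDiffOn hmut hη hcη hsη
    simp only [F]
    rw [integral_sub (hint1 t ht) (hint2 t ht), sub_eq_zero]
    refine Eq.trans (integral_congr_ae (Eventually.of_forall fun x => ?_)) (hEL.trans ?_)
    · by_cases hx : x ∈ B
      · beta_reduce
        rw [← hTL (jet (r + r) _ x) (hmut hx), trunc_jet, jet_add_const_mul hu hξ]
      · simp [image_eq_zero_of_notMem_tsupport fun h => hx (hsη h)]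
    · simp only [jet_add_const_mul hu hξ]
      rfl
  have hD : ∫ x, fderiv ℝ F (0, x) (1, 0) = 0 := by
    refine hd.unique ((hasDerivAt_const (0 : ℝ) (0 : ℝ)).congr_of_eventuallyEq ?_)
    filter_upwards [isOpen_Ioo.mem_nhds hzero] with t ht
    exact hI t ht
  have hpt : ∀ x, fderiv ℝ F (0, x) (1, 0) =
      η x * fderiv ℝ T (jet 2 u x) (jetVar 2 ξ x) -
        fderiv ℝ (fderiv ℝ L) (jet r u x) (jetVar r ξ x) (jetVar r η x) := by
    intro x
    have hFx : DifferentiableAt ℝ F (0, x) :=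
      (hF.contDiffAt ((isOpen_Ioo.prod isOpen_univ).mem_nhds
        ⟨hzero, mem_univ x⟩)).differentiableAt (by simp)
    have h1 := hasDerivAt_fst hFx
    refine h1.unique ?_
    by_cases hx : x ∈ B
    · have e1 := ((hT.contDiffAt (hA.mem_nhds (hmA hx))).differentiableAt
        (by simp)).hasFDerivAt.hasLineDerivAt (jetVar 2 ξ x)
      have e2 := ((hL'.contDiffAt (hW.mem_nhds (hm hx))).differentiableAt
        (by simp)).hasFDerivAt.hasLineDerivAt (jetVar r ξ x)
      have e3 := e2.clm_apply (hasDerivAt_const (0 : ℝ) (jetVar r η x))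
      rw [map_zero, add_zero] at e3
      exact (e1.const_mul (η x)).sub e3
    · have hx' : x ∉ tsupport η := fun h => hx (hsη h)
      simp only [hF0 _ x hx', jetVar_eq_zero hx', image_eq_zero_of_notMem_tsupport hx']
      simpa using hasDerivAt_const (0 : ℝ) (0 : ℝ)
  simp only [hpt] at hD
  rw [integral_sub, sub_eq_zero] at hD
  · exact hD
  · exact integrable_mul_of_tsupport_subset hB hη hcη hsη
      ((hT'.comp (contDiff_jet hu 2).contDiffOn hmA).clm_apply
        (contDiff_jetVar hξ 2).contDiffOn)
  · exact integrable_of_continuousOn_of_eq_zero (ContDiffOn.continuousOn (𝕜 := ℝ) (n := ∞)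
      (((hL''.comp (contDiff_jet hu r).contDiffOn hm).clm_apply
        (contDiff_jetVar hξ r).contDiffOn).clm_apply (contDiff_jetVar hη r).contDiffOn))
      hcη.isCompact hsη fun x hx => by simp [jetVar_eq_zero hx]

/-- The linearization of a variational equation is formally self-adjoint. -/
theorem integral_mul_fderiv_comm {A : Set (Jet n 2)} (hA : IsOpen A) {T : Jet n 2 → ℝ}
    (hT : ContDiffOn ℝ ∞ T A) {r : ℕ} (hr : 2 ≤ r) {W : Set (Jet n r)} (hW : IsOpen W)
    (hWA : MapsTo (trunc 2 hr) W A) {L : Jet n r → ℝ} (hL : ContDiffOn ℝ ∞ L W)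
    (hTL : ∀ w : Jet n (r + r), trunc r (Nat.le_add_left r r) w ∈ W →
        T (trunc 2 (hr.trans (Nat.le_add_left r r)) w) = eulerLagrange L w)
    {u : (Fin n → ℝ) → ℝ} (hu : ContDiff ℝ ∞ u) {B : Set (Fin n → ℝ)} (hB : IsOpen B)
    (hm : MapsTo (jet r u) B W) {ξ η : (Fin n → ℝ) → ℝ} (hξ : ContDiff ℝ ∞ ξ)
    (hη : ContDiff ℝ ∞ η) (hcξ : HasCompactSupport ξ) (hcη : HasCompactSupport η)
    (hsξ : tsupport ξ ⊆ B) (hsη : tsupport η ⊆ B) :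
    ∫ x, η x * fderiv ℝ T (jet 2 u x) (jetVar 2 ξ x) =
      ∫ x, ξ x * fderiv ℝ T (jet 2 u x) (jetVar 2 η x) := by
  rw [integral_mul_fderiv_eq_secondVariation hA hT hr hW hWA hL hTL hu hB hm hξ hη hcξ hcη hsξ hsη,
    integral_mul_fderiv_eq_secondVariation hA hT hr hW hWA hL hTL hu hB hm hη hξ hcη hcξ hsη hsξ]
  refine integral_congr_ae (Eventually.of_forall fun x => ?_)
  beta_reduce
  by_cases hx : x ∈ B
  · have hLx : ContDiffAt ℝ ∞ L (jet r u x) := hL.contDiffAt (hW.mem_nhds (hm hx))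
    -- Self-adjointness is nothing but the symmetry of the second derivative of the Lagrangian.
    exact hLx.isSymmSndFDerivAt (by simpa using ENat.LEInfty.out) _ _
  · simp [jetVar_eq_zero fun h => hx (hsξ h)]

end ScalarJet

/-! ### Vanishing second derivatives in rank-one directions -/

namespace ScalarJet

open Set Filter Topology

open MeasureTheory

variable {n : ℕ}

theorem isOpen_jetsOver {S : Set ((Fin n → ℝ) × ℝ)} (hS : IsOpen S) (k : ℕ) :
    IsOpen (jetsOver S k) :=
  hS.preimage contDiff_pt.continuous

/-- Pointwise form of the self-adjointness of the linearization of a variational equation. -/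
theorem sum_adjoint_eq_linearization {A : Set (Jet n 2)} (hA : IsOpen A) {T : Jet n 2 → ℝ}
    (hT : ContDiffOn ℝ ∞ T A) {r : ℕ} (hr : 2 ≤ r) {W : Set (Jet n r)} (hW : IsOpen W)
    (hWA : MapsTo (trunc 2 hr) W A) {L : Jet n r → ℝ} (hL : ContDiffOn ℝ ∞ L W)
    (hTL : ∀ w : Jet n (r + r), trunc r (Nat.le_add_left r r) w ∈ W →
        T (trunc 2 (hr.trans (Nat.le_add_left r r)) w) = eulerLagrange L w)
    {u : (Fin n → ℝ) → ℝ} (hu : ContDiff ℝ ∞ u) {a : Fin n → ℝ} (ha : jet r u a ∈ W)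
    {η : (Fin n → ℝ) → ℝ} (hη : ContDiff ℝ ∞ η) :
    ∑ s : MIdx n 2, (-1) ^ s.1.card *
        partials (fun x => η x * fderiv ℝ T (jet 2 u x) (eU s)) (s.1.sort (· ≤ ·)) a =
      fderiv ℝ T (jet 2 u a) (jetVar 2 η a) := by
  set B := jet r u ⁻¹' W with hBdef
  have hB : IsOpen B := hW.preimage (contDiff_jet hu r).continuous
  have hm : MapsTo (jet r u) B W := fun x hx => hx
  have hmA : MapsTo (jet 2 u) B A := fun x hx => hWA (hm hx)
  -- The integral identity needs compact support in `B`. Replacing `η` by `ζ = χ η` does not change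
  -- germs at `a`.
  obtain ⟨χ, hχ, hχc, hχs, hχ1⟩ := exists_contDiff_eventually_eq_one (hB.mem_nhds ha)
  let b : MIdx n 2 → (Fin n → ℝ) → ℝ := fun s x => fderiv ℝ T (jet 2 u x) (eU s)
  have hDT : ContDiffOn ℝ ∞ (fun x => fderiv ℝ T (jet 2 u x)) B :=
    (hT.fderiv_of_isOpen hA (by simp)).comp (contDiff_jet hu 2).contDiffOn hmA
  have hb : ∀ s, ContDiffOn ℝ ∞ (b s) B := fun s => hDT.clm_apply contDiffOn_const
  let ζ : (Fin n → ℝ) → ℝ := fun x => χ x * η x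
  have hζ : ContDiff ℝ ∞ ζ := hχ.mul hη
  have hζc : HasCompactSupport ζ := hχc.mul_right
  have hζs : tsupport ζ ⊆ B := (tsupport_mul_subset_left).trans hχs
  have hζη : ζ =ᶠ[𝓝 a] η := by
    filter_upwards [hχ1] with x hx
    simp [ζ, hx]
  have hζb : ∀ s, ContDiff ℝ ∞ fun x => ζ x * b s x := fun s =>
    contDiff_mul_of_tsupport_subset hB (hb s) hζ hζs
  let f : (Fin n → ℝ) → ℝ := fun x =>
    ∑ s : MIdx n 2, (-1) ^ s.1.card * partials (fun x => ζ x * b s x) (s.1.sort (· ≤ ·)) x -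
      fderiv ℝ T (jet 2 u x) (jetVar 2 ζ x)
  have hf1 : ContDiff ℝ ∞ fun x => ∑ s : MIdx n 2, (-1) ^ s.1.card *
      partials (fun x => ζ x * b s x) (s.1.sort (· ≤ ·)) x :=
    ContDiff.sum fun s _ => contDiff_const.mul (contDiff_partials (hζb s) _)
  have hf2 : ContDiffOn ℝ ∞ (fun x => fderiv ℝ T (jet 2 u x) (jetVar 2 ζ x)) B :=
    hDT.clm_apply (contDiff_jetVar hζ 2).contDiffOn
  have hf : ContDiffOn ℝ ∞ f B := hf1.contDiffOn.sub hf2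
  have hint : ∀ ξ : (Fin n → ℝ) → ℝ, ContDiff ℝ ∞ ξ → HasCompactSupport ξ → tsupport ξ ⊆ B →
      ∫ x, ξ x • f x = 0 := by
    intro ξ hξ hξc hξs
    have h1 := integral_mul_fderiv_comm hA hT hr hW hWA hL hTL hu hB hm hξ hζ hξc hζc hξs hζs
    have h2 : ∀ x, ζ x * fderiv ℝ T (jet 2 u x) (jetVar 2 ξ x) =
        ∑ s : MIdx n 2, (ζ x * b s x) * partials ξ (s.1.sort (· ≤ ·)) x := by
      intro x
      rw [jetVar, apply_mk_zero, Finset.mul_sum]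
      exact Finset.sum_congr rfl fun s _ => by simp only [b, jet, mul_assoc]
    have i1 : ∀ s : MIdx n 2, Integrable fun x =>
        (ζ x * b s x) * partials ξ (s.1.sort (· ≤ ·)) x := fun s =>
      integrable_mul_of_tsupport_subset isOpen_univ (hζb s) hζc.mul_right (subset_univ _)
        (contDiff_partials hξ _).contDiffOn
    have i2 : ∀ s : MIdx n 2, Integrable fun x => ξ x *
        ((-1) ^ s.1.card * partials (fun x => ζ x * b s x) (s.1.sort (· ≤ ·)) x) := fun s =>
      integrable_mul_of_tsupport_subset isOpen_univ hξ hξc (subset_univ _)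
        (contDiff_const.mul (contDiff_partials (hζb s) _)).contDiffOn
    simp only [h2] at h1
    rw [integral_finsetSum _ fun s _ => i1 s] at h1
    have h3 : ∀ s : MIdx n 2, ∫ x, (ζ x * b s x) * partials ξ (s.1.sort (· ≤ ·)) x =
        ∫ x, ξ x * ((-1) ^ s.1.card *
          partials (fun x => ζ x * b s x) (s.1.sort (· ≤ ·)) x) := by
      intro s
      rw [integral_mul_partials isOpen_univ (hζb s) hζc.mul_right (subset_univ _)
        hξ.contDiffOn, Multiset.length_sort, ← integral_const_mul]
      exact integral_congr_ae (Eventually.of_forall fun x => by ring)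
    simp only [h3] at h1
    simp only [f, smul_eq_mul, mul_sub, Finset.mul_sum]
    rw [integral_sub (integrable_finsetSum _ fun s _ => i2 s)
      (integrable_mul_of_tsupport_subset hB hξ hξc hξs hf2),
      integral_finsetSum _ fun s _ => i2 s, h1, sub_self]
  -- The fundamental lemma of the calculus of variations; continuity of `f` upgrades it to the point
  -- `a`.
  have hae := hB.ae_eq_zero_of_integral_contDiff_smul_eq_zero
    (hf.continuousOn.locallyIntegrableOn hB.measurableSet) hint
  have hfa : f a = 0 := by
    refine Measure.eqOn_open_of_ae_eq (μ := volume) (f := f) (g := fun _ => 0) ?_ hB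
      hf.continuousOn continuousOn_const ha
    exact (ae_restrict_iff' hB.measurableSet).2 hae
  have e1 : ∀ s : MIdx n 2, partials (fun x => ζ x * b s x) (s.1.sort (· ≤ ·)) a =
      partials (fun x => η x * b s x) (s.1.sort (· ≤ ·)) a := fun s =>
    (partials_eventuallyEq (hζη.mul EventuallyEq.rfl) _).self_of_nhds
  have e2 : jetVar 2 ζ a = jetVar 2 η a := by
    simp only [jetVar, (jet_eventuallyEq hζη 2).self_of_nhds]
  simp only [f, e1, e2] at hfa
  exact sub_eq_zero.1 hfa

/-- The vertical vector with second-order components `k_μ k_ν`. -/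
noncomputable def rankOne (k : Fin n → ℝ) : Jet n 2 :=
  (0, fun s => if s.1.card = 2 then (s.1.map k).prod else 0)

theorem rankOne_snd (k : Fin n → ℝ) (s : MIdx n 2) :
    (rankOne k).2 s = if s.1.card = 2 then (s.1.map k).prod else 0 := rfl

/-- The divided power `(∑_μ k_μ (x_μ - a_μ))^m / m!`. -/
noncomputable def planePower (k a : Fin n → ℝ) (m : ℕ) (x : Fin n → ℝ) : ℝ :=
  (∑ μ, k μ * (x μ - a μ)) ^ m / m.factorial

theorem contDiff_planePower (k a : Fin n → ℝ) (m : ℕ) : ContDiff ℝ ∞ (planePower k a m) := by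
  unfold planePower
  fun_prop

theorem planePower_self (k a : Fin n → ℝ) (m : ℕ) :
    planePower k a m a = if m = 0 then 1 else 0 := by
  split_ifs with h <;> simp [planePower, h]

theorem fderiv_planePower_succ (k a : Fin n → ℝ) (m : ℕ) (x : Fin n → ℝ) (μ : Fin n) :
    fderiv ℝ (planePower k a (m + 1)) x (Pi.single μ 1) = k μ * planePower k a m x := by
  have h0 : HasFDerivAt (fun x : Fin n → ℝ => ∑ μ, k μ * (x μ - a μ))
      (∑ μ, k μ • ContinuousLinearMap.proj (R := ℝ) (φ := fun _ : Fin n => ℝ) μ) x :=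
    HasFDerivAt.fun_sum fun μ _ => ((hasFDerivAt_apply μ x).sub_const (a μ)).const_mul (k μ)
  have h1 : HasFDerivAt (planePower k a (m + 1)) _ x :=
    (h0.pow (m + 1)).mul_const (((m + 1).factorial : ℝ)⁻¹)
  rw [h1.fderiv]
  have hm : (m.factorial : ℝ) ≠ 0 := by positivity
  have hm1 : (m + 1 : ℝ) ≠ 0 := by positivity
  simp [planePower, Nat.factorial_succ, Pi.single_apply, sum_apply]
  field_simp

theorem fderiv_planePower_zero (k a : Fin n → ℝ) : fderiv ℝ (planePower k a 0) = 0 := by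
  have : planePower k a 0 = fun _ => 1 := by
    funext x
    simp [planePower]
  rw [this]
  simp

theorem partials_planePower (k a : Fin n → ℝ) (m : ℕ) (l : List (Fin n)) :
    partials (planePower k a m) l = fun x =>
      if l.length ≤ m then (l.map k).prod * planePower k a (m - l.length) x else 0 := by
  induction l with
  | nil => simp [partials]
  | cons μ l ih =>
    funext x
    change fderiv ℝ (partials (planePower k a m) l) x _ = _
    rw [ih]
    by_cases h : l.length ≤ m
    · simp only [if_pos h]
      rw [fderiv_const_mul ((contDiff_planePower k a _).differentiable (by simp) x)]
      by_cases h' : l.length + 1 ≤ m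
      · obtain ⟨c, hc⟩ := Nat.exists_eq_add_of_le h'
        have e1 : m - l.length = c + 1 := by omega
        have e2 : m - (l.length + 1) = c := by omega
        rw [e1, smul_apply, fderiv_planePower_succ, List.length_cons, if_pos h', e2]
        simp
        ring
      · have e1 : m - l.length = 0 := by omega
        rw [e1, fderiv_planePower_zero, List.length_cons, if_neg h']
        simp
    · have h' : ¬ (μ :: l).length ≤ m := by
        rw [List.length_cons]; omega
      simp only [if_neg h, if_neg h']
      simp

theorem jetVar_planePower_self (k a : Fin n → ℝ) {m q : ℕ} (h : q < m) :
    jetVar q (planePower k a m) a = 0 := by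
  refine Prod.ext rfl (funext fun s => ?_)
  change partials _ _ a = 0
  have hs : s.1.card < m := s.2.trans_lt h
  rw [partials_planePower]
  beta_reduce
  rw [planePower_self, Multiset.length_sort, if_pos hs.le, if_neg (by omega), mul_zero]

/-- The cubic has vanishing 2-jet at `a`, but its third derivatives there are `k_μ k_ν k_ρ`. It
moves the first derivatives of the 2-jet without moving the 2-jet itself. -/
theorem fderiv_jetVar_planePower (k a : Fin n → ℝ) (μ : Fin n) :
    fderiv ℝ (jetVar 2 (planePower k a 3)) a (Pi.single μ 1) = k μ • rankOne k := by
  have hd : ∀ s : MIdx n 2, HasFDerivAt (partials (planePower k a 3) (s.1.sort (· ≤ ·)))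
      (fderiv ℝ (partials (planePower k a 3) (s.1.sort (· ≤ ·))) a) a := fun s =>
    ((contDiff_partials (contDiff_planePower k a 3) _).differentiable (by simp) a).hasFDerivAt
  have h : HasFDerivAt (jetVar 2 (planePower k a 3)) ((0 : (Fin n → ℝ) →L[ℝ] (Fin n → ℝ)).prod
      (ContinuousLinearMap.pi fun s : MIdx n 2 =>
        fderiv ℝ (partials (planePower k a 3) (s.1.sort (· ≤ ·))) a)) a :=
    (hasFDerivAt_const _ _).prodMk (hasFDerivAt_pi.2 hd)
  rw [h.fderiv]
  refine Prod.ext (by simp [rankOne]) (funext fun s => ?_)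
  change partials (planePower k a 3) (μ :: s.1.sort (· ≤ ·)) a = k μ * _
  have hs := s.2
  have hprod : ((s.1.sort (· ≤ ·)).map k).prod = (s.1.map k).prod := by
    conv_rhs => rw [← Multiset.sort_eq s.1 (· ≤ ·), Multiset.map_coe, Multiset.prod_coe]
  rw [partials_planePower]
  beta_reduce
  rw [planePower_self, List.length_cons, Multiset.length_sort,
    if_pos (by omega), List.map_cons, List.prod_cons, hprod]
  by_cases h2 : s.1.card = 2
  · simp [h2, rankOne_snd]
  · rw [rankOne_snd, if_neg (by omega), if_neg h2]
    simp

/-- The factor `k·(x-a)` vanishes at `a` and has constant gradient `k`, so second derivatives of the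
product see only first derivatives of `b`. -/
theorem partials_planePower_mul {k a : Fin n → ℝ} {b : (Fin n → ℝ) → ℝ} {B : Set (Fin n → ℝ)}
    (hB : IsOpen B) (ha : a ∈ B) (hb : ContDiffOn ℝ ∞ b B) :
    partials (fun x => planePower k a 1 x * b x) [] a = 0 ∧
    (∀ μ, partials (fun x => planePower k a 1 x * b x) [μ] a = k μ * b a) ∧
    ∀ μ ν, partials (fun x => planePower k a 1 x * b x) [μ, ν] a =
      k μ * fderiv ℝ b a (Pi.single ν 1) + k ν * fderiv ℝ b a (Pi.single μ 1) := by
  have hp : ∀ x, DifferentiableAt ℝ (planePower k a 1) x := fun x =>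
    (contDiff_planePower k a 1).differentiable (by simp) x
  have hbd : ∀ x ∈ B, DifferentiableAt ℝ b x := fun x hx =>
    (hb.contDiffAt (hB.mem_nhds hx)).differentiableAt (by simp)
  have hp1 : ∀ x ν, fderiv ℝ (planePower k a 1) x (Pi.single ν 1) = k ν := fun x ν => by
    rw [fderiv_planePower_succ]; simp [planePower]
  have hp0 : planePower k a 1 a = 0 := by simp [planePower_self]
  have h1 : ∀ ν, ∀ x ∈ B, partials (fun x => planePower k a 1 x * b x) [ν] x =
      planePower k a 1 x * fderiv ℝ b x (Pi.single ν 1) + b x * k ν := by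
    intro ν x hx
    change fderiv ℝ (fun x => planePower k a 1 x * b x) x _ = _
    rw [fderiv_fun_mul (hp x) (hbd x hx)]
    simp [hp1]
  refine ⟨by simp [partials, hp0], fun μ => by rw [h1 μ a ha, hp0]; ring, fun μ ν => ?_⟩
  have h2 : partials (fun x => planePower k a 1 x * b x) [ν] =ᶠ[𝓝 a] fun x =>
      planePower k a 1 x * fderiv ℝ b x (Pi.single ν 1) + b x * k ν := by
    filter_upwards [hB.mem_nhds ha] with x hx using h1 ν x hx
  have hd2 : DifferentiableAt ℝ (fun x => fderiv ℝ b x (Pi.single ν 1)) a :=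
    ((contDiffOn_partials hB hb [ν]).contDiffAt (hB.mem_nhds ha)).differentiableAt (by simp)
  change fderiv ℝ (partials _ [ν]) a _ = _
  rw [h2.fderiv_eq, fderiv_fun_add ((hp a).fun_mul hd2) ((hbd a ha).mul_const _),
    fderiv_fun_mul (hp a) hd2, fderiv_mul_const (hbd a ha)]
  simp [hp1, hp0]
  ring

/-- The left-hand sides of a locally variational second-order equation have vanishing second
derivatives in the directions `k_μ k_ν`. -/
theorem fderiv_fderiv_rankOne {S : Set ((Fin n → ℝ) × ℝ)} (hS : IsOpen S) {T : Jet n 2 → ℝ}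
    (hT : ContDiffOn ℝ ∞ T (jetsOver S 2)) (hvar : LocallyVariational S T) {j : Jet n 2}
    (hj : j ∈ jetsOver S 2) (k : Fin n → ℝ) :
    fderiv ℝ (fderiv ℝ T) j (rankOne k) (rankOne k) = 0 := by
  obtain ⟨r, hr, W₀, L, hW₀, ⟨w, hw, rfl⟩, hL₀, hTL₀⟩ := hvar j hj
  have hA := isOpen_jetsOver hS 2
  set A := jetsOver S 2
  set W := W₀ ∩ trunc 2 hr ⁻¹' A
  have hW : IsOpen W := hW₀.inter (hA.preimage (contDiff_trunc hr).continuous)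
  have hWA : MapsTo (trunc 2 hr) W A := fun w hw => hw.2
  have hL : ContDiffOn ℝ ∞ L W := hL₀.mono inter_subset_left
  have hTL : ∀ w : Jet n (r + r), trunc r (Nat.le_add_left r r) w ∈ W →
      T (trunc 2 (hr.trans (Nat.le_add_left r r)) w) = eulerLagrange L w :=
    fun w hw => hTL₀ w hw.1
  obtain ⟨u, hu, huw⟩ := exists_jet_eq w
  set a := w.1
  have hwW : jet r u a ∈ W := by rw [huw]; exact ⟨hw, hj⟩
  set p := planePower k a 3
  have hp : ContDiff ℝ ∞ p := contDiff_planePower k a 3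
  have hcont : Continuous fun t : ℝ => jet r u a + t • jetVar r p a := by fun_prop
  -- For `r ≥ 3` the cubic can change the `r`-jet, so `t` must be small to remain in `W`; it must be
  -- nonzero to be divided out at the end.
  have hev : ∀ᶠ t in 𝓝[≠] (0 : ℝ), jet r u a + t • jetVar r p a ∈ W :=
    (hcont.continuousAt.eventually (hW.mem_nhds (by simpa using hwW))).filter_mono
      nhdsWithin_le_nhds
  obtain ⟨t, htW, ht0⟩ := (hev.and self_mem_nhdsWithin).exists
  have hut : ContDiff ℝ ∞ fun x => u x + t * p x := hu.add (contDiff_const.mul hp)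
  rw [← jet_add_const_mul hu hp] at htW
  have e₀ := sum_adjoint_eq_linearization hA hT hr hW hWA hL hTL hu hwW
    (contDiff_planePower k a 1)
  have e₁ := sum_adjoint_eq_linearization hA hT hr hW hWA hL hTL hut htW
    (contDiff_planePower k a 1)
  have hj2 : trunc 2 hr w = jet 2 u a := by rw [← huw]; rfl
  have hjt : jet 2 (fun x => u x + t * p x) a = jet 2 u a := by
    rw [jet_add_const_mul hu hp, jetVar_planePower_self k a (by norm_num), smul_zero, add_zero]
  rw [hj2]
  -- Both sections have the same 2-jet at `a`, hence the same linearization there. Thus their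
  -- adjoint expressions agree as well, although their third derivatives may differ.
  rw [hjt, ← e₀, ← sub_eq_zero, ← Finset.sum_sub_distrib] at e₁
  have hT' : ContDiffOn ℝ ∞ (fderiv ℝ T) A := hT.fderiv_of_isOpen hA (by simp)
  have hjA : jet 2 u a ∈ A := hj2 ▸ hj
  have hT'd : DifferentiableAt ℝ (fderiv ℝ T) (jet 2 u a) :=
    (hT'.contDiffAt (hA.mem_nhds hjA)).differentiableAt (by simp)
  have hb : ∀ {v : (Fin n → ℝ) → ℝ}, ContDiff ℝ ∞ v → ∀ s : MIdx n 2,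
      ContDiffOn ℝ ∞ (fun x => fderiv ℝ T (jet 2 v x) (eU s)) (jet 2 v ⁻¹' A) := fun hv s =>
    (hT'.comp (contDiff_jet hv 2).contDiffOn fun _ hx => hx).clm_apply contDiffOn_const
  have hbopen : ∀ {v : (Fin n → ℝ) → ℝ}, ContDiff ℝ ∞ v → IsOpen (jet 2 v ⁻¹' A) := fun hv =>
    hA.preimage (contDiff_jet hv 2).continuous
  have hder : ∀ (s : MIdx n 2) (μ : Fin n),
      fderiv ℝ (fun x => fderiv ℝ T (jet 2 (fun x => u x + t * p x) x) (eU s)) a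
        (Pi.single μ 1) = fderiv ℝ (fun x => fderiv ℝ T (jet 2 u x) (eU s)) a (Pi.single μ 1) +
          t * k μ * fderiv ℝ (fderiv ℝ T) (jet 2 u a) (rankOne k) (eU s) := by
    intro s μ
    have hf : HasFDerivAt (fun i => fderiv ℝ T i (eU s))
        ((fderiv ℝ (fderiv ℝ T) (jet 2 u a)).flip (eU s)) (jet 2 u a) := by
      refine (hT'd.hasFDerivAt.clm_apply (hasFDerivAt_const (eU s) _)).congr_fderiv ?_
      simp
    have hju : HasFDerivAt (jet 2 u) (fderiv ℝ (jet 2 u) a) a :=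
      ((contDiff_jet hu 2).differentiable (by simp) a).hasFDerivAt
    have hjp : HasFDerivAt (jetVar 2 p) (fderiv ℝ (jetVar 2 p) a) a :=
      ((contDiff_jetVar hp 2).differentiable (by simp) a).hasFDerivAt
    have hjut : HasFDerivAt (jet 2 fun x => u x + t * p x)
        (fderiv ℝ (jet 2 u) a + t • fderiv ℝ (jetVar 2 p) a) a := by
      have : (jet 2 fun x => u x + t * p x) = fun x => jet 2 u x + t • jetVar 2 p x :=
        funext fun x => jet_add_const_mul hu hp t 2 x
      rw [this]
      exact hju.add (hjp.const_smul t)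
    have g0 := (hf.comp a hju).fderiv
    have g1 := (HasFDerivAt.comp a (by rw [hjt]; exact hf) hjut).fderiv
    change fderiv ℝ ((fun i => fderiv ℝ T i (eU s)) ∘ _) a _ =
      fderiv ℝ ((fun i => fderiv ℝ T i (eU s)) ∘ _) a _ + _
    rw [g0, g1]
    simp [p, fderiv_jetVar_planePower]
    ring
  -- Only indices of length two contribute: each of the two product-rule terms changes by `t k_μ
  -- k_ν` times the mixed second derivative of `T`.
  have hterm : ∀ s : MIdx n 2, (-1) ^ s.1.card * partials (fun x => planePower k a 1 x *
      fderiv ℝ T (jet 2 (fun x => u x + t * p x) x) (eU s)) (s.1.sort (· ≤ ·)) a -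
      (-1) ^ s.1.card * partials (fun x => planePower k a 1 x *
        fderiv ℝ T (jet 2 u x) (eU s)) (s.1.sort (· ≤ ·)) a =
      2 * t * (fderiv ℝ (fderiv ℝ T) (jet 2 u a) (rankOne k) (eU s) * (rankOne k).2 s) := by
    intro s
    obtain ⟨p0, p1, p2⟩ := partials_planePower_mul (k := k) (hbopen hu) hjA (hb hu s)
    obtain ⟨q0, q1, q2⟩ := partials_planePower_mul (k := k) (hbopen hut)
      (show a ∈ jet 2 _ ⁻¹' A by rw [mem_preimage, hjt]; exact hjA) (hb hut s)
    have hlen := Multiset.length_sort (s := s.1) (r := (· ≤ ·))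
    have hs := s.2
    have hprod : (s.1.map k).prod = ((s.1.sort (· ≤ ·)).map k).prod := by
      conv_lhs => rw [← Multiset.sort_eq s.1 (· ≤ ·), Multiset.map_coe, Multiset.prod_coe]
    have hsnd : (rankOne k).2 s = if (s.1.sort (· ≤ ·)).length = 2 then
        ((s.1.sort (· ≤ ·)).map k).prod else 0 := by
      rw [hlen, ← hprod, rankOne_snd]
    rw [hsnd, ← hlen]
    rw [← hlen] at hs
    rcases h : s.1.sort (· ≤ ·) with _ | ⟨μ, _ | ⟨ν, _ | ⟨_, _⟩⟩⟩
    · simp [p0, q0]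
    · rw [p1, q1, hjt]
      simp
    · rw [p2, q2, hder, hder]
      simp
      ring
    · rw [h] at hs
      simp at hs
  simp only [hterm] at e₁
  rw [← Finset.mul_sum, ← apply_mk_zero] at e₁
  have h2 : (2 * t : ℝ) ≠ 0 := mul_ne_zero two_ne_zero ht0
  exact (mul_eq_zero.1 e₁).resolve_left h2

end ScalarJet

/-! ### Smoothness of the lift and its action on jets of sections -/

namespace ScalarJet

open Set Filter Topology

variable {n : ℕ}

section Matrix

variable {E : Type*} [NormedAddCommGroup E] [NormedSpace ℝ E] {s : Set E}

theorem contDiffOn_det {m : ℕ} {A : E → Matrix (Fin m) (Fin m) ℝ}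
    (h : ∀ i j, ContDiffOn ℝ ∞ (fun x => A x i j) s) :
    ContDiffOn ℝ ∞ (fun x => (A x).det) s := by
  simp only [Matrix.det_apply]
  exact ContDiffOn.sum fun σ _ => (contDiffOn_prod fun i _ => h _ _).const_smul _

theorem contDiffOn_matrix_inv {m : ℕ} {A : E → Matrix (Fin m) (Fin m) ℝ}
    (h : ∀ i j, ContDiffOn ℝ ∞ (fun x => A x i j) s) (h0 : ∀ x ∈ s, (A x).det ≠ 0)
    (i j : Fin m) : ContDiffOn ℝ ∞ (fun x => (A x)⁻¹ i j) s := by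
  simp only [Matrix.inv_def, Matrix.smul_apply, Matrix.adjugate_apply, Ring.inverse_eq_inv',
    smul_eq_mul]
  refine ((contDiffOn_det h).inv h0).mul (contDiffOn_det fun a b => ?_)
  by_cases ha : a = j
  · subst ha
    simp only [Matrix.updateRow_self]
    exact contDiffOn_const
  · simp only [Matrix.updateRow_ne ha]
    exact h a b

end Matrix

variable {S : Set ((Fin n → ℝ) × ℝ)} {φ : (Fin n → ℝ) × ℝ → (Fin n → ℝ) × ℝ}

theorem contDiffOn_baseMap (hφ : ContDiffOn ℝ ∞ φ S) (μ : Fin n) :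
    ContDiffOn ℝ ∞ (fun i : Jet n 0 => (φ (pt i)).1 μ) (jetsOver S 0) :=
  (contDiff_apply ℝ ℝ μ).comp_contDiffOn
    (contDiff_fst.comp_contDiffOn (hφ.comp contDiff_pt.contDiffOn fun _ h => h))

theorem contDiffOn_baseJac (hS : IsOpen S) (hφ : ContDiffOn ℝ ∞ φ S) (ν μ : Fin n) :
    ContDiffOn ℝ ∞ (fun j => baseJac φ j ν μ) (jetsOver S 1) :=
  contDiffOn_totalD (isOpen_jetsOver hS 0) (contDiffOn_baseMap hφ μ) ν

/-- The domain of the derivative coordinates of the lift. -/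
def coordDomain (S : Set ((Fin n → ℝ) × ℝ)) (φ : (Fin n → ℝ) × ℝ → (Fin n → ℝ) × ℝ) :
    (l : List (Fin n)) → Set (Jet n l.length)
  | [] => jetsOver S 0
  | _ :: l => jetsOver S (l.length + 1) ∩
      trunc 1 (Nat.le_add_left 1 l.length) ⁻¹' {j | j ∈ jetsOver S 1 ∧ (baseJac φ j).det ≠ 0}

theorem isOpen_regularJets (hS : IsOpen S) (hφ : ContDiffOn ℝ ∞ φ S) :
    IsOpen {j : Jet n 1 | j ∈ jetsOver S 1 ∧ (baseJac φ j).det ≠ 0} :=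
  (contDiffOn_det (contDiffOn_baseJac hS hφ)).continuousOn.isOpen_inter_preimage
    (isOpen_jetsOver hS 1) isOpen_compl_singleton

theorem isOpen_coordDomain (hS : IsOpen S) (hφ : ContDiffOn ℝ ∞ φ S) (l : List (Fin n)) :
    IsOpen (coordDomain S φ l) := by
  cases l with
  | nil => exact isOpen_jetsOver hS 0
  | cons μ l =>
    exact (isOpen_jetsOver hS _).inter
      ((isOpen_regularJets hS hφ).preimage (contDiff_trunc _).continuous)

theorem contDiffOn_liftCoord (hS : IsOpen S) (hφ : ContDiffOn ℝ ∞ φ S) (l : List (Fin n)) :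
    ContDiffOn ℝ ∞ (liftCoord φ l) (coordDomain S φ l) := by
  induction l with
  | nil => exact contDiff_snd.comp_contDiffOn (hφ.comp contDiff_pt.contDiffOn fun _ h => h)
  | cons μ l ih =>
    have hsub : coordDomain S φ (μ :: l) ⊆
        trunc l.length (Nat.le_succ l.length) ⁻¹' coordDomain S φ l := by
      intro j hj
      cases l with
      | nil => exact hj.1
      | cons ν l => exact ⟨hj.1, hj.2⟩
    have hA : ∀ ν μ, ContDiffOn ℝ ∞
        (fun j : Jet n (l.length + 1) =>
          baseJac φ (trunc 1 (Nat.le_add_left 1 l.length) j) ν μ) (coordDomain S φ (μ :: l)) :=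
      fun ν μ => (contDiffOn_baseJac hS hφ ν μ).comp (contDiff_trunc _).contDiffOn
        fun j hj => hj.2.1
    have hB : ∀ ν, ContDiffOn ℝ ∞ (totalD ν (liftCoord φ l)) (coordDomain S φ (μ :: l)) :=
      fun ν => (contDiffOn_totalD (isOpen_coordDomain hS hφ l) ih ν).mono hsub
    change ContDiffOn ℝ ∞ (fun j => ∑ ν,
      (baseJac φ (trunc 1 (Nat.le_add_left 1 l.length) j))⁻¹ μ ν * totalD ν (liftCoord φ l) j) _
    exact ContDiffOn.sum fun ν _ =>
      (contDiffOn_matrix_inv hA (fun j hj => hj.2.2) μ ν).mul (hB ν)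

theorem isOpen_liftDomain (hS : IsOpen S) (hφ : ContDiffOn ℝ ∞ φ S) :
    IsOpen (liftDomain S φ) :=
  (isOpen_regularJets hS hφ).preimage (contDiff_trunc (n := n) (one_le_two)).continuous

theorem contDiffOn_lift (hS : IsOpen S) (hφ : ContDiffOn ℝ ∞ φ S) :
    ContDiffOn ℝ ∞ (lift 2 φ) (liftDomain S φ) := by
  refine (contDiff_fst.comp_contDiffOn (hφ.comp contDiff_pt.contDiffOn fun j hj => hj.1)).prodMk
    (contDiffOn_pi.2 fun s => ?_)
  refine (contDiffOn_liftCoord hS hφ _).comp (contDiff_trunc _).contDiffOn fun j hj => ?_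
  have key : ∀ (l : List (Fin n)) (h : l.length ≤ 2), trunc l.length h j ∈ coordDomain S φ l := by
    intro l h
    cases l with
    | nil => exact hj.1
    | cons ν l => exact ⟨hj.1, hj.1, hj.2⟩
  exact key _ _

variable {u : (Fin n → ℝ) → ℝ} {U : Set (Fin n → ℝ)}

theorem contDiffOn_graph (hφ : ContDiffOn ℝ ∞ φ S) (hu : IsEvolution S U u) :
    ContDiffOn ℝ ∞ (fun x => φ (x, u x)) U :=
  hφ.comp (contDiffOn_id.prodMk hu.2.1) hu.2.2

theorem baseJac_jet (hS : IsOpen S) (hφ : ContDiffOn ℝ ∞ φ S) (hu : IsEvolution S U u)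
    {x : Fin n → ℝ} (hx : x ∈ U) (ν μ : Fin n) :
    baseJac φ (jet 1 u x) ν μ =
      fderiv ℝ (fun x => (φ (x, u x)).1) x (Pi.single ν 1) μ := by
  have hd : DifferentiableAt ℝ (fun i : Jet n 0 => (φ (pt i)).1 μ) (jet 0 u x) :=
    ((contDiffOn_baseMap hφ μ).contDiffAt ((isOpen_jetsOver hS 0).mem_nhds
      (by simpa [jetsOver] using hu.2.2 x hx))).differentiableAt (by simp)
  have hg : DifferentiableAt ℝ (fun x => (φ (x, u x)).1) x :=
    ((contDiffOn_graph hφ hu).fst.contDiffAt (hu.1.mem_nhds hx)).differentiableAt (by simp)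
  change totalD ν _ _ = _
  rw [totalD_jet hu.1 hu.2.1 hx hd]
  simp only [pt_jet]
  rw [show (fun y => (φ (y, u y)).1 μ) = fun y => (fun x => (φ (x, u x)).1) y μ from rfl,
    fderiv_apply hg]
  rfl

theorem det_baseJac_jet (hS : IsOpen S) (hφ : ContDiffOn ℝ ∞ φ S) (hu : IsEvolution S U u)
    {x : Fin n → ℝ} (hx : x ∈ U) :
    (baseJac φ (jet 1 u x)).det = (fderiv ℝ (fun x => (φ (x, u x)).1) x).det := by
  have : baseJac φ (jet 1 u x) =
      (LinearMap.toMatrix' (fderiv ℝ (fun x => (φ (x, u x)).1) x).toLinearMap).transpose := by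
    ext ν μ
    rw [baseJac_jet hS hφ hu hx, Matrix.transpose_apply, LinearMap.toMatrix'_apply]
    congr 2
  rw [this, Matrix.det_transpose, LinearMap.det_toMatrix']

/-- The lift of the jet of a section is the jet of the image section. -/
theorem liftCoord_jet (hS : IsOpen S) (hφ : ContDiffOn ℝ ∞ φ S) (hu : IsEvolution S U u)
    (hdet : ∀ x ∈ U, (baseJac φ (jet 1 u x)).det ≠ 0) {V : Set (Fin n → ℝ)} (hV : IsOpen V)
    {v : (Fin n → ℝ) → ℝ} (hv : ContDiffOn ℝ ∞ v V)
    (hUV : ∀ x ∈ U, (φ (x, u x)).1 ∈ V ∧ v (φ (x, u x)).1 = (φ (x, u x)).2)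
    (l : List (Fin n)) :
    ∀ x ∈ U, liftCoord φ l (jet l.length u x) = partials v l (φ (x, u x)).1 := by
  induction l with
  | nil =>
    intro x hx
    simp [liftCoord, partials, (hUV x hx).2]
  | cons μ l ih =>
    intro x hx
    have hmem : jet l.length u x ∈ coordDomain S φ l := by
      have h1 : (x, u x) ∈ S := hu.2.2 x hx
      cases l with
      | nil => simpa [coordDomain, jetsOver] using h1
      | cons ν l => exact ⟨by simpa [jetsOver] using h1, by simpa [jetsOver] using h1, hdet x hx⟩
    have hd : DifferentiableAt ℝ (liftCoord φ l) (jet l.length u x) :=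
      ((contDiffOn_liftCoord hS hφ l).contDiffAt
        ((isOpen_coordDomain hS hφ l).mem_nhds hmem)).differentiableAt (by simp)
    set g := fun x => (φ (x, u x)).1 with hgdef
    have hg : DifferentiableAt ℝ g x :=
      ((contDiffOn_graph hφ hu).fst.contDiffAt (hu.1.mem_nhds hx)).differentiableAt (by simp)
    have hp : DifferentiableAt ℝ (partials v l) (g x) :=
      ((contDiffOn_partials hV hv l).contDiffAt (hV.mem_nhds (hUV x hx).1)).differentiableAt
        (by simp)
    have hev : (fun y => liftCoord φ l (jet l.length u y)) =ᶠ[𝓝 x] partials v l ∘ g := by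
      filter_upwards [hu.1.mem_nhds hx] with y hy using ih y hy
    -- The induction hypothesis says that the coordinate along `u` is `partials v l ∘ g`. Its chain
    -- rule is exactly the linear system defining the next lift coordinates.
    have hD : (fun ν => totalD ν (liftCoord φ l) (jet (l.length + 1) u x)) =
        (baseJac φ (jet 1 u x)).mulVec fun μ => partials v (μ :: l) (g x) := by
      funext ν
      rw [totalD_jet hu.1 hu.2.1 hx hd, hev.fderiv_eq, fderiv_comp x hp hg]
      change fderiv ℝ (partials v l) (g x) (fderiv ℝ g x (Pi.single ν 1)) = _
      conv_lhs => rw [pi_eq_sum_univ' (fderiv ℝ g x (Pi.single ν 1)), map_sum]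
      refine Finset.sum_congr rfl fun κ _ => ?_
      rw [map_smul]
      exact congrArg (· * _) (baseJac_jet hS hφ hu hx ν κ).symm
    change ((baseJac φ (jet 1 u x))⁻¹.mulVec
      fun ν => totalD ν (liftCoord φ l) (jet (l.length + 1) u x)) μ = _
    rw [hD, Matrix.mulVec_mulVec, Matrix.nonsing_inv_mul _ (isUnit_iff_ne_zero.2 (hdet x hx)),
      Matrix.one_mulVec]

theorem lift_jet (hS : IsOpen S) (hφ : ContDiffOn ℝ ∞ φ S) (hu : IsEvolution S U u)
    (hdet : ∀ x ∈ U, (baseJac φ (jet 1 u x)).det ≠ 0) {V : Set (Fin n → ℝ)} (hV : IsOpen V)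
    {v : (Fin n → ℝ) → ℝ} (hv : ContDiffOn ℝ ∞ v V)
    (hUV : ∀ x ∈ U, (φ (x, u x)).1 ∈ V ∧ v (φ (x, u x)).1 = (φ (x, u x)).2)
    (k : ℕ) {x : Fin n → ℝ} (hx : x ∈ U) :
    lift k φ (jet k u x) = jet k v (φ (x, u x)).1 := by
  refine Prod.ext ?_ (funext fun s => liftCoord_jet hS hφ hu hdet hV hv hUV _ x hx)
  simp [lift, jet, pt, partials]

end ScalarJet

/-! ### Transport of sections, zeros of the equation, and fibres of the lift -/

namespace ScalarJet

open Set Filter Topology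

variable {n : ℕ} {S : Set ((Fin n → ℝ) × ℝ)}

theorem pt_lift (k : ℕ) (φ : (Fin n → ℝ) × ℝ → (Fin n → ℝ) × ℝ) (j : Jet n k) :
    pt (lift k φ j) = φ (pt j) := by
  -- The type of `liftCoord φ l` depends on `l`, so the sorted list is generalized before it is
  -- replaced by `[]`.
  have key : ∀ (l : List (Fin n)) (h : l.length ≤ k), l = [] →
      liftCoord φ l (trunc l.length h j) = (φ (pt j)).2 := by
    rintro l h rfl
    rfl
  exact Prod.ext rfl (key _ _ (Multiset.sort_zero _))

section Diffeo

variable {φ : OpenPartialHomeomorph ((Fin n → ℝ) × ℝ) ((Fin n → ℝ) × ℝ)}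

theorem IsDiffeoOf.symm (hφ : IsDiffeoOf S φ) : IsDiffeoOf S φ.symm :=
  ⟨hφ.2.1, hφ.1, hφ.2.2.2, by simpa using hφ.2.2.1⟩

theorem IsDiffeoOf.map_mem (hφ : IsDiffeoOf S φ) {p : (Fin n → ℝ) × ℝ} (hp : p ∈ S) :
    φ p ∈ S := by
  have := φ.map_source (hφ.1.symm ▸ hp)
  rwa [hφ.2.1] at this

theorem IsDiffeoOf.symm_apply (hφ : IsDiffeoOf S φ) {p : (Fin n → ℝ) × ℝ} (hp : p ∈ S) :
    φ.symm (φ p) = p :=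
  φ.left_inv (hφ.1.symm ▸ hp)

variable {u : (Fin n → ℝ) → ℝ} {U : Set (Fin n → ℝ)}

/-- The inverse function theorem for `x ↦ f(x, u x)`, whose Jacobian determinant is `det (D_ν f^μ)`.
The image section is `F(x, u x)` expressed in the new base coordinates. The final clauses say that
`φ.symm` transports it back. -/
theorem IsDiffeoOf.exists_image_section (hS : IsOpen S) (hφ : IsDiffeoOf S φ)
    (hu : IsEvolution S U u) {x : Fin n → ℝ} (hx : x ∈ U)
    (hdet : (baseJac φ (jet 1 u x)).det ≠ 0) :
    ∃ U₀ ⊆ U, x ∈ U₀ ∧ IsEvolution S U₀ u ∧ (∀ y ∈ U₀, (baseJac φ (jet 1 u y)).det ≠ 0) ∧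
      ∃ V v, IsEvolution S V v ∧ φ '' sectionImage U₀ u = sectionImage V v ∧
        (∀ y ∈ U₀, (φ (y, u y)).1 ∈ V ∧ v (φ (y, u y)).1 = (φ (y, u y)).2) ∧
        ∀ z ∈ V, (baseJac φ.symm (jet 1 v z)).det ≠ 0 ∧ (φ.symm (z, v z)).1 ∈ U₀ ∧
          u (φ.symm (z, v z)).1 = (φ.symm (z, v z)).2 := by
  have hφs := hφ.2.2.1
  set g := fun y => (φ (y, u y)).1 with hg
  have hgU : ContDiffOn ℝ ∞ g U := (contDiffOn_graph hφs hu).fst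
  have hO := isOpen_regularJets hS hφs
  set A := U ∩ jet 1 u ⁻¹' {j : Jet n 1 | j ∈ jetsOver S 1 ∧ (baseJac φ j).det ≠ 0} with hAdef
  have hA : IsOpen A :=
    (contDiffOn_jet hu.1 hu.2.1 1).continuousOn.isOpen_inter_preimage hu.1 hO
  have hjS : ∀ y ∈ U, jet 1 u y ∈ jetsOver S 1 := fun y hy => by
    simpa [jetsOver] using hu.2.2 y hy
  have hxA : x ∈ A := ⟨hx, hjS x hx, hdet⟩
  have hdet' : (fderiv ℝ g x).det ≠ 0 := by rwa [← det_baseJac_jet hS hφs hu hx]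
  have hgx : HasFDerivAt g ((fderiv ℝ g x).toContinuousLinearEquivOfDetNeZero hdet' :
      (Fin n → ℝ) →L[ℝ] (Fin n → ℝ)) x := by
    rw [ContinuousLinearMap.coe_toContinuousLinearEquivOfDetNeZero]
    exact ((hgU.contDiffAt (hu.1.mem_nhds hx)).differentiableAt (by simp)).hasFDerivAt
  obtain ⟨e, hxe, heA, he, hsymm⟩ :=
    exists_openPartialHomeomorph_contDiffOn_symm hA (hgU.mono inter_subset_left) hxA hgx
  have heU : e.source ⊆ U := heA.trans inter_subset_left
  have hu₀ : IsEvolution S e.source u :=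
    ⟨e.open_source, hu.2.1.mono heU, fun y hy => hu.2.2 y (heU hy)⟩
  set v := fun z => (φ (e.symm z, u (e.symm z))).2 with hvdef
  have hφv : ∀ z ∈ e.target, φ (e.symm z, u (e.symm z)) = (z, v z) := by
    intro z hz
    refine Prod.ext ?_ rfl
    change g (e.symm z) = z
    rw [← he, e.right_inv hz]
  have hsv : ∀ z ∈ e.target, φ.symm (z, v z) = (e.symm z, u (e.symm z)) := by
    intro z hz
    rw [← hφv z hz, hφ.symm_apply (hu₀.2.2 _ (e.map_target hz))]
  have hv : IsEvolution S e.target v := by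
    refine ⟨e.open_target, ((contDiffOn_graph hφs hu).comp hsymm
      fun z hz => heU (e.map_target hz)).snd, fun z hz => ?_⟩
    rw [← hφv z hz]
    exact hφ.map_mem (hu₀.2.2 _ (e.map_target hz))
  have hfwd : ∀ y ∈ e.source, (φ (y, u y)).1 ∈ e.target ∧
      v (φ (y, u y)).1 = (φ (y, u y)).2 := by
    intro y hy
    have : (φ (y, u y)).1 = e y := (he y).symm
    rw [this]
    refine ⟨e.map_source hy, ?_⟩
    simp only [hvdef, e.left_inv hy]
  refine ⟨e.source, heU, hxe, hu₀, fun y hy => (heA hy).2.2, e.target, v, hv, ?_, hfwd,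
    fun z hz => ⟨?_, ?_, ?_⟩⟩
  · ext p
    constructor
    · rintro ⟨_, ⟨y, hy, rfl⟩, rfl⟩
      exact ⟨_, (hfwd y hy).1, Prod.ext rfl (hfwd y hy).2⟩
    · rintro ⟨z, hz, rfl⟩
      exact ⟨_, ⟨e.symm z, e.map_target hz, rfl⟩, hφv z hz⟩
  · have hev : (fun z => (φ.symm (z, v z)).1) =ᶠ[𝓝 z] e.symm := by
      filter_upwards [e.open_target.mem_nhds hz] with y hy
      rw [hsv y hy]
    rw [det_baseJac_jet hS hφ.symm.2.2.1 hv hz, hev.fderiv_eq]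
    -- The base map of `φ.symm` along `v` is the local inverse of `g`; by the chain rule its
    -- determinant is nonzero.
    have hid : g ∘ e.symm =ᶠ[𝓝 z] id := by
      filter_upwards [e.open_target.mem_nhds hz] with y hy
      change g (e.symm y) = y
      rw [← he, e.right_inv hy]
    have hgd : DifferentiableAt ℝ g (e.symm z) :=
      (hgU.contDiffAt (hu.1.mem_nhds (heU (e.map_target hz)))).differentiableAt (by simp)
    have hed : DifferentiableAt ℝ e.symm z :=
      (hsymm.contDiffAt (e.open_target.mem_nhds hz)).differentiableAt (by simp)
    have hcomp := fderiv_comp z hgd hed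
    rw [hid.fderiv_eq, fderiv_id] at hcomp
    have := congrArg ContinuousLinearMap.det hcomp
    intro h0
    have hmul : (fderiv ℝ g (e.symm z) ∘L fderiv ℝ e.symm z).det =
        (fderiv ℝ g (e.symm z)).det * (fderiv ℝ e.symm z).det := LinearMap.det_comp _ _
    rw [hmul, h0, mul_zero] at this
    simp [ContinuousLinearMap.det] at this
  · rw [hsv z hz]; exact e.map_target hz
  · rw [hsv z hz]

variable {T : Jet n 2 → ℝ} {𝒰 : Set (Set (Fin n → ℝ))}

theorem IsDiffeoOf.lift_mem_jetsOver (hφ : IsDiffeoOf S φ) {j : Jet n 2}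
    (hj : j ∈ jetsOver S 2) : lift 2 φ j ∈ jetsOver S 2 := by
  change pt (lift 2 φ j) ∈ S
  rw [pt_lift]
  exact hφ.map_mem hj

/-- The lift of a symmetry maps zeros of the equation to zeros. -/
theorem IsDiffeoOf.apply_lift_eq_zero (hS : IsOpen S) (hφ : IsDiffeoOf S φ)
    (hT : ContDiffOn ℝ ∞ T (jetsOver S 2))
    (hsolv : ∀ j ∈ jetsOver S 2, T j = 0 → j ∈ closure (solutionJets S T 𝒰))
    (hsym : MapsSolutions S T 𝒰 φ) {j : Jet n 2} (hj : j ∈ liftDomain S φ) (h0 : T j = 0) :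
    T (lift 2 φ j) = 0 := by
  by_contra hne
  have hD := isOpen_liftDomain hS hφ.2.2.1
  have hcont : ContinuousAt (fun i => T (lift 2 φ i)) j :=
    ((hT.comp (contDiffOn_lift hS hφ.2.2.1) fun i hi =>
      hφ.lift_mem_jetsOver hi.1).continuousOn).continuousAt (hD.mem_nhds hj)
  -- If `T` were nonzero at the lifted jet, it would be so at the lifts of nearby jets, including a
  -- solution jet in the open domain, contradicting the symmetry.
  obtain ⟨i, ⟨U, hU, u, hu, x, hx, rfl⟩, hi, hiD⟩ :=
    ((mem_closure_iff_frequently.1 (hsolv j hj.1 h0)).and_eventually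
      ((hcont.eventually_ne hne).and (hD.mem_nhds hj))).exists
  obtain ⟨U₀, hU₀, hx₀, hu₀, hdet, V, v, hv, himg, hUV, -⟩ :=
    hφ.exists_image_section hS hu.1 hx hiD.2
  have hsol := hsym U hU u hu U₀ hU₀ hu₀.1 V v hv himg
  apply hi
  rw [lift_jet hS hφ.2.2.1 hu₀ hdet hv.1 hv.2.1 hUV 2 hx₀]
  exact hsol.2 _ (hUV x hx₀).1

/-- Represent `j` by a section and transport it forth and back; no computation with lift coordinates
is needed. -/
theorem IsDiffeoOf.lift_symm_lift (hS : IsOpen S) (hφ : IsDiffeoOf S φ) {j : Jet n 2}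
    (hj : j ∈ liftDomain S φ) :
    lift 2 φ j ∈ liftDomain S φ.symm ∧ lift 2 φ.symm (lift 2 φ j) = j := by
  obtain ⟨u, hu, huj⟩ := exists_jet_eq j
  set x := j.1
  set U : Set (Fin n → ℝ) := {y | (y, u y) ∈ S}
  have hUo : IsOpen U := hS.preimage (continuous_id.prodMk hu.continuous)
  have huE : IsEvolution S U u := ⟨hUo, hu.contDiffOn, fun y hy => hy⟩
  have hjx : jet 2 u x ∈ liftDomain S φ := by rw [huj]; exact hj
  have hx : x ∈ U := by
    have : pt (jet 2 u x) ∈ S := hjx.1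
    rwa [pt_jet] at this
  obtain ⟨U₀, hU₀, hx₀, hu₀, hdet, V, v, hv, himg, hUV, hVU⟩ :=
    hφ.exists_image_section hS huE hx hjx.2
  have hl := lift_jet hS hφ.2.2.1 hu₀ hdet hv.1 hv.2.1 hUV 2 hx₀
  rw [huj] at hl
  have hz := (hUV x hx₀).1
  set z := (φ (x, u x)).1 with hzdef
  have hzv : (z, v z) = φ (x, u x) := Prod.ext rfl (hUV x hx₀).2
  rw [hl]
  refine ⟨⟨by simpa [jetsOver] using hv.2.2 z hz, (hVU z hz).1⟩, ?_⟩
  rw [lift_jet hS hφ.symm.2.2.1 hv (fun z hz => (hVU z hz).1) hu₀.1 hu₀.2.1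
    (fun z hz => (hVU z hz).2) 2 hz, hzv, hφ.symm_apply (hU₀ hx₀), huj]

theorem IsDiffeoOf.eq_zero_of_apply_lift (hS : IsOpen S) (hφ : IsDiffeoOf S φ)
    (hT : ContDiffOn ℝ ∞ T (jetsOver S 2))
    (hsolv : ∀ j ∈ jetsOver S 2, T j = 0 → j ∈ closure (solutionJets S T 𝒰))
    (hsym : MapsSolutions S T 𝒰 φ.symm) {j : Jet n 2} (hj : j ∈ liftDomain S φ)
    (h0 : T (lift 2 φ j) = 0) : T j = 0 := by
  obtain ⟨h1, h2⟩ := hφ.lift_symm_lift hS hj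
  rw [← h2]
  exact hφ.symm.apply_lift_eq_zero hS hT hsolv hsym h1 h0

end Diffeo

section Fibre

variable {φ : (Fin n → ℝ) × ℝ → (Fin n → ℝ) × ℝ}

@[simp]
theorem trunc_add_smul_rankOne (j : Jet n 2) (t : ℝ) (k : Fin n → ℝ) :
    trunc 1 one_le_two (j + t • rankOne k) = trunc 1 one_le_two j := by
  refine Prod.ext (by simp [trunc, rankOne]) (funext fun s => ?_)
  have hs : ¬ s.1.card = 2 := by have := s.2; omega
  simp [trunc, rankOne_snd, hs]

/-- The vertical vector with first-order components `k_μ`. -/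
noncomputable def covector (k : Fin n → ℝ) : Jet n 1 :=
  (0, fun s => if s.1.card = 1 then (s.1.map k).prod else 0)

theorem trunc_add_smul_covector (j : Jet n 1) (t : ℝ) (k : Fin n → ℝ) :
    trunc 0 zero_le_one (j + t • covector k) = trunc 0 zero_le_one j := by
  refine Prod.ext (by simp [trunc, covector]) (funext fun s => ?_)
  have hs : ¬ s.1.card = 1 := by have := s.2; omega
  simp only [trunc, covector, Prod.snd_add, Prod.smul_snd, Pi.add_apply, Pi.smul_apply, hs,
    if_false, smul_zero, add_zero]

/-- The second-order coordinates enter the total derivative linearly, and contracting `k⊗k` with the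
index `ρ` leaves `k_ρ` times the covector `k`. -/
theorem totalD_add_smul_rankOne (f : Jet n 1 → ℝ) (ρ : Fin n) (j : Jet n 2) (t : ℝ)
    (k : Fin n → ℝ) : totalD ρ f (j + t • rankOne k) =
      totalD ρ f j + t * k ρ * fderiv ℝ f (trunc 1 one_le_two j) (covector k) := by
  have h : ((Pi.single ρ 1, fun s => (j + t • rankOne k).2
      ⟨ρ ::ₘ s.1, by simpa using s.2⟩) : Jet n 1) =
      (Pi.single ρ 1, fun s => j.2 ⟨ρ ::ₘ s.1, by simpa using s.2⟩) +
        (t * k ρ) • covector k := by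
    refine Prod.ext (by simp [covector]) (funext fun s => ?_)
    simp only [Prod.snd_add, Prod.smul_snd, Pi.add_apply, Pi.smul_apply, rankOne_snd, covector,
      Multiset.card_cons, smul_eq_mul, Multiset.map_cons, Multiset.prod_cons]
    by_cases h1 : s.1.card = 1
    · rw [if_pos h1, if_pos (by omega)]
      ring
    · rw [if_neg h1, if_neg (by omega), mul_zero, mul_zero]
  change fderiv ℝ f (trunc 1 one_le_two (j + t • rankOne k)) _ =
    fderiv ℝ f (trunc 1 one_le_two j) _ + _
  rw [trunc_add_smul_rankOne, h, map_add, map_smul, smul_eq_mul]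

theorem totalD_add_smul_covector (f : Jet n 0 → ℝ) (ρ : Fin n) (j : Jet n 1) (t : ℝ)
    (k : Fin n → ℝ) : totalD ρ f (j + t • covector k) =
      totalD ρ f j + t * k ρ * fderiv ℝ f (trunc 0 zero_le_one j) (eU ⟨0, by simp⟩) := by
  have h : ((Pi.single ρ 1, fun s => (j + t • covector k).2
      ⟨ρ ::ₘ s.1, by simpa using s.2⟩) : Jet n 0) =
      (Pi.single ρ 1, fun s => j.2 ⟨ρ ::ₘ s.1, by simpa using s.2⟩) +
        (t * k ρ) • eU ⟨0, by simp⟩ := by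
    refine Prod.ext (by simp [eU]) (funext fun s => ?_)
    obtain ⟨s, hs⟩ := s
    have hs0 : s = 0 := by simpa using hs
    subst hs0
    simp [covector, eU]
  change fderiv ℝ f (trunc 0 zero_le_one (j + t • covector k)) _ =
    fderiv ℝ f (trunc 0 zero_le_one j) _ + _
  rw [trunc_add_smul_covector, h, map_add, map_smul, smul_eq_mul]

/-- Differentiate the system `∑_μ (D_ρ f^μ) ψ'_μ = D_ρ F` along `k`. The changes of the matrix and
of the right-hand side are both multiples of `k_ρ`, so the matrix sends the derivative of `ψ'` to a
multiple of `k`. -/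
theorem fderiv_liftCoord_covector (hS : IsOpen S) (hφ : ContDiffOn ℝ ∞ φ S) {m : Jet n 1}
    (hm : m ∈ jetsOver S 1) (hdet : (baseJac φ m).det ≠ 0) (k : Fin n → ℝ) :
    ∃ c : ℝ, ∀ ν, fderiv ℝ (liftCoord φ [ν]) m (covector k) =
      c * ((baseJac φ m)⁻¹.mulVec k) ν := by
  set α : Fin n → ℝ := fun μ => fderiv ℝ (fun i : Jet n 0 => (φ (pt i)).1 μ)
    (trunc 0 zero_le_one m) (eU ⟨0, by simp⟩)
  set β : ℝ := fderiv ℝ (liftCoord φ []) (trunc 0 zero_le_one m) (eU ⟨0, by simp⟩)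
  set G : Jet n 1 → Fin n → ℝ := fun i ν => liftCoord φ [ν] i
  set γ : Fin n → ℝ := fun ν => fderiv ℝ (liftCoord φ [ν]) m (covector k)
  have hopen := isOpen_regularJets hS hφ
  have hline : Continuous fun t : ℝ => m + t • covector k := by fun_prop
  have hev : ∀ᶠ t in 𝓝 (0 : ℝ), (baseJac φ (m + t • covector k)).mulVec
      (G (m + t • covector k)) = fun ρ => totalD ρ (liftCoord φ []) (m + t • covector k) := by
    filter_upwards [hline.continuousAt.eventually
      (hopen.mem_nhds (by simpa using ⟨hm, hdet⟩))] with t ht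
    change (baseJac φ (m + t • covector k)).mulVec ((baseJac φ (m + t • covector k))⁻¹.mulVec
      fun ρ => totalD ρ (liftCoord φ []) (m + t • covector k)) = _
    rw [Matrix.mulVec_mulVec, Matrix.mul_nonsing_inv _ (isUnit_iff_ne_zero.2 ht.2),
      Matrix.one_mulVec]
  have hG : ∀ ν, HasDerivAt (fun t : ℝ => G (m + t • covector k) ν) (γ ν) 0 := by
    intro ν
    have hd : DifferentiableAt ℝ (liftCoord φ [ν]) m :=
      ((contDiffOn_liftCoord hS hφ [ν]).contDiffAt
        ((isOpen_coordDomain hS hφ [ν]).mem_nhds ⟨hm, hm, hdet⟩)).differentiableAt (by simp)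
    exact hd.hasFDerivAt.hasLineDerivAt (covector k)
  have hkey : ∀ ρ, k ρ * (∑ μ, α μ * G m μ) + (baseJac φ m).mulVec γ ρ = k ρ * β := by
    intro ρ
    have h1 : HasDerivAt (fun t : ℝ => ∑ μ, (baseJac φ m ρ μ + t * k ρ * α μ) *
        G (m + t • covector k) μ)
        (∑ μ, ((1 * k ρ * α μ) * G (m + (0 : ℝ) • covector k) μ +
          (baseJac φ m ρ μ + 0 * k ρ * α μ) * γ μ)) 0 :=
      HasDerivAt.fun_sum fun μ _ => HasDerivAt.mul
        ((((hasDerivAt_id (0 : ℝ)).mul_const (k ρ)).mul_const (α μ)).const_add _) (hG μ)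
    have h2 : HasDerivAt (fun t : ℝ => totalD ρ (liftCoord φ []) m + t * k ρ * β)
        (1 * k ρ * β) 0 :=
      (((hasDerivAt_id (0 : ℝ)).mul_const (k ρ)).mul_const β).const_add _
    have h3 := h1.unique (h2.congr_of_eventuallyEq (by
      filter_upwards [hev] with t ht
      have := congrFun ht ρ
      rw [totalD_add_smul_covector] at this
      rw [← this]
      refine Finset.sum_congr rfl fun μ _ => ?_
      congr 1
      exact (totalD_add_smul_covector _ ρ m t k).symm))
    simp only [one_mul, zero_smul, add_zero, zero_mul, Finset.sum_add_distrib] at h3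
    rw [← h3, Finset.mul_sum]
    simp only [mul_assoc]
    rfl
  -- This constant is `∂F/∂ψ - ∑_μ (∂f^μ/∂ψ) ψ'_μ`.
  refine ⟨β - ∑ μ, α μ * G m μ, fun ν => ?_⟩
  have hγ : (baseJac φ m).mulVec γ = (β - ∑ μ, α μ * G m μ) • k := by
    funext ρ
    simp only [Pi.smul_apply, smul_eq_mul]
    linarith [hkey ρ]
  have : γ = (baseJac φ m)⁻¹.mulVec ((baseJac φ m).mulVec γ) := by
    rw [Matrix.mulVec_mulVec, Matrix.nonsing_inv_mul _ (isUnit_iff_ne_zero.2 hdet),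
      Matrix.one_mulVec]
  change γ ν = _
  rw [this, hγ, Matrix.mulVec_smul]
  simp

/-- The lift acts affinely on the fibres over first-order jets and preserves the rank one
directions. -/
theorem exists_lift_add_smul_rankOne (hS : IsOpen S) (hφ : ContDiffOn ℝ ∞ φ S) {j : Jet n 2}
    (hj : j ∈ liftDomain S φ) (k : Fin n → ℝ) :
    ∃ (c : ℝ) (k' : Fin n → ℝ), ∀ t : ℝ,
      lift 2 φ (j + t • rankOne k) = lift 2 φ j + (t * c) • rankOne k' := by
  obtain ⟨c, hc⟩ := fderiv_liftCoord_covector hS hφ (m := trunc 1 one_le_two j) hj.1 hj.2 k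
  set k' := (baseJac φ (trunc 1 one_le_two j))⁻¹.mulVec k with hk'
  refine ⟨c, k', fun t => ?_⟩
  have hpt : pt (j + t • rankOne k) = pt j :=
    congrArg (fun i : Jet n 1 => pt i) (trunc_add_smul_rankOne j t k)
  have key : ∀ (l : List (Fin n)) (h : l.length ≤ 2),
      liftCoord φ l (trunc l.length h (j + t • rankOne k)) =
        liftCoord φ l (trunc l.length h j) +
          t * c * if l.length = 2 then (l.map k').prod else 0 := by
    intro l h
    rcases l with _ | ⟨μ, _ | ⟨ν, _ | ⟨_, _⟩⟩⟩
    · have := congrArg (trunc 0 zero_le_one) (trunc_add_smul_rankOne j t k)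
      simp only [trunc_trunc] at this
      simp [this]
    · simp only [List.length_cons, List.length_nil, Nat.zero_add] at h ⊢
      rw [trunc_add_smul_rankOne]
      simp
    · change ((baseJac φ (trunc 1 one_le_two (j + t • rankOne k)))⁻¹.mulVec
        fun ρ => totalD ρ (liftCoord φ [ν]) (j + t • rankOne k)) μ =
        ((baseJac φ (trunc 1 one_le_two j))⁻¹.mulVec
        fun ρ => totalD ρ (liftCoord φ [ν]) j) μ + _
      -- The increment is `t c k'_ν k`; applying the inverse Jacobian turns `k` into `k'`, giving
      -- the symmetric increment `t c k'_μ k'_ν`.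
      have hD : (fun ρ => totalD ρ (liftCoord φ [ν]) (j + t • rankOne k)) =
          (fun ρ => totalD ρ (liftCoord φ [ν]) j) + (t * c * k' ν) • k := by
        funext ρ
        have := totalD_add_smul_rankOne (liftCoord φ [ν]) ρ j t k
        refine this.trans ?_
        rw [hc ν]
        simp only [Pi.add_apply, Pi.smul_apply, smul_eq_mul]
        ring
      rw [trunc_add_smul_rankOne, hD, Matrix.mulVec_add, Matrix.mulVec_smul]
      simp [← hk']
      ring
    · simp at h
  refine Prod.ext ?_ (funext fun s => ?_)
  · change (φ (pt (j + t • rankOne k))).1 = (φ (pt j)).1 + (t * c) • (0 : Fin n → ℝ)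
    rw [hpt, smul_zero, add_zero]
  · have := key (s.1.sort (· ≤ ·)) (by simpa using s.2)
    have hprod : ((s.1.sort (· ≤ ·)).map k').prod = (s.1.map k').prod := by
      conv_rhs => rw [← Multiset.sort_eq s.1 (· ≤ ·), Multiset.map_coe, Multiset.prod_coe]
    rw [hprod] at this
    refine this.trans ?_
    congr 2
    rw [rankOne_snd, Multiset.length_sort]

end Fibre

end ScalarJet

/-! ### Fibre coordinates, extension of the fibrewise ratio, and pull-back of the form -/

namespace ScalarJet

open Set Filter Topology

variable {n : ℕ} {S : Set ((Fin n → ℝ) × ℝ)} {T : Jet n 2 → ℝ}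

/-- The multi-indices of length two. -/
abbrev TopIdx (n : ℕ) : Type := {s : MIdx n 2 // s.1.card = 2}

/-- The inclusion of the second-order components as vertical vectors. -/
noncomputable def vert (n : ℕ) : (TopIdx n → ℝ) →L[ℝ] Jet n 2 :=
  (0 : (TopIdx n → ℝ) →L[ℝ] (Fin n → ℝ)).prod
    (ContinuousLinearMap.pi fun s => if h : s.1.card = 2 then
      ContinuousLinearMap.proj (R := ℝ) (φ := fun _ : TopIdx n => ℝ) ⟨s, h⟩ else 0)

/-- The second-order components `k_μ k_ν`. -/
def symSq (k : Fin n → ℝ) (s : TopIdx n) : ℝ := (s.1.1.map k).prod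

theorem vert_fst (a : TopIdx n → ℝ) : (vert n a).1 = 0 := rfl

theorem vert_snd (a : TopIdx n → ℝ) (s : MIdx n 2) :
    (vert n a).2 s = if h : s.1.card = 2 then a ⟨s, h⟩ else 0 := by
  change (if h : s.1.card = 2 then
      ContinuousLinearMap.proj (R := ℝ) (φ := fun _ : TopIdx n => ℝ) ⟨s, h⟩ else 0) a = _
  split_ifs <;> rfl

theorem vert_symSq (k : Fin n → ℝ) : vert n (symSq k) = rankOne k := by
  refine Prod.ext rfl (funext fun s => ?_)
  rw [vert_snd, rankOne_snd]
  split_ifs <;> rfl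

theorem trunc_add_vert (j : Jet n 2) (a : TopIdx n → ℝ) :
    trunc 1 one_le_two (j + vert n a) = trunc 1 one_le_two j := by
  refine Prod.ext (by simp [trunc, vert_fst]) (funext fun s => ?_)
  have hs : ¬ s.1.card = 2 := by have := s.2; omega
  simp [trunc, vert_snd, hs]

theorem exists_eq_add_vert {i j : Jet n 2} (h : SameFirstJet i j) : ∃ a, i = j + vert n a := by
  refine ⟨fun s => i.2 s.1 - j.2 s.1, Prod.ext ?_ (funext fun s => ?_)⟩
  · rw [Prod.fst_add, vert_fst, add_zero]
    exact congrArg (fun m : Jet n 1 => m.1) h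
  · rw [Prod.snd_add, Pi.add_apply, vert_snd]
    split_ifs with hs
    · simp
    · have hs1 : s.1.card ≤ 1 := by have := s.2; omega
      rw [add_zero]
      exact congrFun (congrArg (fun m : Jet n 1 => m.2) h) ⟨s.1, hs1⟩

theorem SameFirstJet.mem_jetsOver {i j : Jet n 2} (h : SameFirstJet i j)
    (hj : j ∈ jetsOver S 2) : i ∈ jetsOver S 2 := by
  have : pt i = pt j := congrArg (fun m : Jet n 1 => pt m) h
  change pt i ∈ S
  rw [this]
  exact hj

theorem SameFirstJet.mem_liftDomain {φ : (Fin n → ℝ) × ℝ → (Fin n → ℝ) × ℝ} {i j : Jet n 2}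
    (h : SameFirstJet i j) (hj : j ∈ liftDomain S φ) : i ∈ liftDomain S φ :=
  ⟨h.mem_jetsOver hj.1, by rw [show trunc 1 one_le_two i = trunc 1 one_le_two j from h]; exact hj.2⟩

/-- Polarization: `(e_μ + e_ν)² - e_μ² - e_ν²` is the basis vector of `{μ, ν}`, up to a factor `2`
when `μ = ν`. -/
theorem span_range_symSq :
    Submodule.span ℝ (range (symSq : (Fin n → ℝ) → TopIdx n → ℝ)) = ⊤ := by
  rw [eq_top_iff, ← (Pi.basisFun ℝ (TopIdx n)).span_eq, Submodule.span_le]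
  rintro _ ⟨⟨⟨s, hs'⟩, hs⟩, rfl⟩
  obtain ⟨μ, ν, rfl⟩ := Multiset.card_eq_two.1 hs
  have hmem : ∀ k : Fin n → ℝ, symSq k ∈ Submodule.span ℝ
      (range (symSq : (Fin n → ℝ) → TopIdx n → ℝ)) :=
    fun k => Submodule.subset_span ⟨k, rfl⟩
  have h : (Pi.single ⟨⟨{μ, ν}, hs'⟩, hs⟩ 1 : TopIdx n → ℝ) = (if μ = ν then 2 else 1 : ℝ)⁻¹ •
      (symSq (Pi.single μ 1 + Pi.single ν 1) - symSq (Pi.single μ 1) -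
        symSq (Pi.single ν 1)) := by
    funext ⟨⟨t, ht'⟩, ht⟩
    obtain ⟨α, β, rfl⟩ := Multiset.card_eq_two.1 ht
    have hiff : (⟨⟨{α, β}, ht'⟩, ht⟩ : TopIdx n) = ⟨⟨{μ, ν}, hs'⟩, hs⟩ ↔
        (α = μ ∧ β = ν) ∨ (α = ν ∧ β = μ) := by
      rw [Subtype.ext_iff, Subtype.ext_iff]
      constructor
      · intro h
        have h' : α ::ₘ {β} = μ ::ₘ {ν} := h
        rw [Multiset.cons_eq_cons] at h'
        rcases h' with ⟨h1, h2⟩ | ⟨h1, cs, h2, h3⟩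
        · exact Or.inl ⟨h1, Multiset.singleton_inj.1 h2⟩
        · have hc : cs = 0 := by
            have := congrArg Multiset.card h2
            simpa using this
          subst hc
          exact Or.inr ⟨(Multiset.singleton_inj.1 h3).symm, Multiset.singleton_inj.1 h2⟩
      · rintro (⟨rfl, rfl⟩ | ⟨rfl, rfl⟩)
        · rfl
        · exact Multiset.pair_comm _ _
    have hprod : ∀ k : Fin n → ℝ, symSq k ⟨⟨{α, β}, ht'⟩, ht⟩ = k α * k β :=
      fun k => by simp [symSq]
    simp only [Pi.smul_apply, Pi.sub_apply, hprod, Pi.add_apply, Pi.single_apply, hiff,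
      smul_eq_mul]
    by_cases h1 : α = μ <;> by_cases h2 : β = ν <;> by_cases h3 : α = ν <;>
      by_cases h4 : β = μ <;> by_cases h5 : μ = ν <;> subst_vars <;> simp_all <;> norm_num
  rw [Pi.basisFun_apply, h]
  exact Submodule.smul_mem _ _ (Submodule.sub_mem _ (Submodule.sub_mem _ (hmem _) (hmem _))
    (hmem _))

theorem symSq_add_smul (k m : Fin n → ℝ) (t : ℝ) :
    symSq (k + t • m) =
      symSq k + t • (symSq (k + m) - symSq k - symSq m) + t ^ 2 • symSq m := by
  funext ⟨⟨s, hs'⟩, hs⟩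
  obtain ⟨α, β, rfl⟩ := Multiset.card_eq_two.1 hs
  simp [symSq]
  ring

/-- The whole line stays over one first-order jet, hence in `J²(S)`, so the vanishing second
derivative can be integrated twice for all `t`. -/
theorem exists_apply_add_smul_rankOne (hS : IsOpen S) (hT : ContDiffOn ℝ ∞ T (jetsOver S 2))
    (hvar : LocallyVariational S T) {j : Jet n 2} (hj : j ∈ jetsOver S 2) (k : Fin n → ℝ) :
    ∃ b : ℝ, ∀ t : ℝ, T (j + t • rankOne k) = T j + t * b := by
  have hA := isOpen_jetsOver hS 2
  have hmem : ∀ t : ℝ, j + t • rankOne k ∈ jetsOver S 2 := fun t =>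
    SameFirstJet.mem_jetsOver (trunc_add_smul_rankOne j t k) hj
  have hline : ∀ t : ℝ, HasDerivAt (fun t : ℝ => j + t • rankOne k) (rankOne k) t := fun t => by
    simpa using ((hasDerivAt_id t).smul_const (rankOne k)).const_add j
  have h1 : ∀ t : ℝ, HasDerivAt (fun t : ℝ => T (j + t • rankOne k))
      (fderiv ℝ T (j + t • rankOne k) (rankOne k)) t := fun t =>
    (((hT.contDiffAt (hA.mem_nhds (hmem t))).differentiableAt
      (by simp)).hasFDerivAt).comp_hasDerivAt t (hline t)
  have hT' : ContDiffOn ℝ ∞ (fderiv ℝ T) (jetsOver S 2) := hT.fderiv_of_isOpen hA (by simp)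
  have h2 : ∀ t : ℝ, HasDerivAt (fun t : ℝ => fderiv ℝ T (j + t • rankOne k) (rankOne k)) 0 t := by
    intro t
    have hd : DifferentiableAt ℝ (fderiv ℝ T) (j + t • rankOne k) :=
      (hT'.contDiffAt (hA.mem_nhds (hmem t))).differentiableAt (by simp)
    have hf : HasFDerivAt (fun i => fderiv ℝ T i (rankOne k))
        ((fderiv ℝ (fderiv ℝ T) (j + t • rankOne k)).flip (rankOne k)) (j + t • rankOne k) := by
      refine (hd.hasFDerivAt.clm_apply (hasFDerivAt_const (rankOne k) _)).congr_fderiv ?_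
      simp
    refine (hf.comp_hasDerivAt t (hline t)).congr_deriv ?_
    exact fderiv_fderiv_rankOne hS hT hvar (hmem t) k
  set b := fderiv ℝ T j (rankOne k)
  have h3 : ∀ t : ℝ, fderiv ℝ T (j + t • rankOne k) (rankOne k) = b := fun t => by
    have := is_const_of_deriv_eq_zero (fun t => (h2 t).differentiableAt)
      (fun t => (h2 t).deriv) t 0
    simpa using this
  refine ⟨b, fun t => ?_⟩
  have h4 : ∀ t : ℝ, HasDerivAt (fun t : ℝ => T (j + t • rankOne k) - t * b) 0 t := fun t => by
    have := (h1 t).sub ((hasDerivAt_id t).mul_const b)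
    rw [h3, one_mul, sub_self] at this
    exact this
  have := is_const_of_deriv_eq_zero (fun t => (h4 t).differentiableAt)
      (fun t => (h4 t).deriv) t 0
  simp only [zero_smul, add_zero, zero_mul, sub_zero] at this
  linarith

theorem affineAlong_fibre (hS : IsOpen S) (hT : ContDiffOn ℝ ∞ T (jetsOver S 2))
    (hvar : LocallyVariational S T) {j : Jet n 2} (hj : j ∈ jetsOver S 2) :
    AffineAlong symSq fun a => T (j + vert n a) := by
  intro a k
  obtain ⟨b, hb⟩ := exists_apply_add_smul_rankOne hS hT hvar
    (SameFirstJet.mem_jetsOver (trunc_add_vert j a) hj) k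
  refine ⟨b, fun t => ?_⟩
  beta_reduce
  rw [map_add, map_smul, vert_symSq, ← add_assoc]
  exact hb t

theorem affineAlong_fibre_lift {φ : OpenPartialHomeomorph ((Fin n → ℝ) × ℝ) ((Fin n → ℝ) × ℝ)}
    (hS : IsOpen S) (hT : ContDiffOn ℝ ∞ T (jetsOver S 2)) (hvar : LocallyVariational S T)
    (hφ : IsDiffeoOf S φ) {j : Jet n 2} (hj : j ∈ liftDomain S φ) :
    AffineAlong symSq fun a => T (lift 2 φ (j + vert n a)) := by
  intro a k
  have hja : j + vert n a ∈ liftDomain S φ := SameFirstJet.mem_liftDomain (trunc_add_vert j a) hj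
  obtain ⟨c, k', hk'⟩ := exists_lift_add_smul_rankOne hS hφ.2.2.1 hja k
  obtain ⟨b, hb⟩ := exists_apply_add_smul_rankOne hS hT hvar (hφ.lift_mem_jetsOver hja.1) k'
  refine ⟨c * b, fun t => ?_⟩
  beta_reduce
  rw [map_add, map_smul, vert_symSq, ← add_assoc, hk', hb]
  ring

theorem contDiff_fibre {A : Set (Jet n 2)} {f : Jet n 2 → ℝ} (hf : ContDiffOn ℝ ∞ f A)
    {j : Jet n 2} (hj : ∀ a, j + vert n a ∈ A) : ContDiff ℝ ∞ fun a => f (j + vert n a) := by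
  rw [← contDiffOn_univ]
  exact hf.comp (contDiff_const.add (vert n).contDiff).contDiffOn fun a _ => hj a

/-- A function on the second-order jets that is constant on the fibres and, on the fibres over
which `T` does not vanish identically, is the quotient of `Q` and `T`. -/
noncomputable def fibreRatio (T Q : Jet n 2 → ℝ) (m : Jet n 1) : ℝ :=
  open Classical in
  if h : ∃ i : Jet n 2, trunc 1 one_le_two i = m ∧ T i ≠ 0 then Q h.choose / T h.choose else 0

/-- The first-order jets over which `T` does not vanish identically. -/
def nonzeroFibres (T : Jet n 2 → ℝ) : Set (Jet n 1) :=
  {m | ∃ i : Jet n 2, trunc 1 one_le_two i = m ∧ T i ≠ 0}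

theorem fibreRatio_eq {T Q : Jet n 2 → ℝ} {m : Jet n 1} (hm : m ∈ nonzeroFibres T) {c : ℝ}
    (h : ∀ i, trunc 1 one_le_two i = m → Q i = c * T i) : fibreRatio T Q m = c := by
  have hm' : ∃ i : Jet n 2, trunc 1 one_le_two i = m ∧ T i ≠ 0 := hm
  rw [fibreRatio, dif_pos hm', h _ hm'.choose_spec.1]
  exact mul_div_cancel_right₀ c hm'.choose_spec.2

/-- The second-order jet over `m` with the second-order components of `i`. -/
def fibreSection (i : Jet n 2) (m : Jet n 1) : Jet n 2 :=
  (m.1, fun s => if h : s.1.card ≤ 1 then m.2 ⟨s.1, h⟩ else i.2 s)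

theorem contDiff_fibreSection (i : Jet n 2) : ContDiff ℝ ∞ (fibreSection i) := by
  refine contDiff_fst.prodMk (contDiff_pi.2 fun s => ?_)
  by_cases h : s.1.card ≤ 1
  · simp only [dif_pos h]
    exact (contDiff_apply ℝ ℝ _).comp contDiff_snd
  · simp only [dif_neg h]
    exact contDiff_const

theorem fibreSection_trunc (i : Jet n 2) : fibreSection i (trunc 1 one_le_two i) = i := by
  refine Prod.ext rfl (funext fun s => ?_)
  simp only [fibreSection, trunc]
  split_ifs <;> rfl

theorem trunc_fibreSection (i : Jet n 2) (m : Jet n 1) :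
    trunc 1 one_le_two (fibreSection i m) = m := by
  refine Prod.ext rfl (funext fun s => ?_)
  simp only [fibreSection, trunc, s.2, dif_pos]

/-- The quotient of two functions that are proportional along the fibres extends smoothly across the
fibres on which the denominator vanishes identically but its differential does not. -/
theorem exists_contDiffAt_extendFrom {A : Set (Jet n 2)} (hA : IsOpen A)
    {Q : Jet n 2 → ℝ} (hT : ContDiffOn ℝ ∞ T A) (hQ : ContDiffOn ℝ ∞ Q A)
    (haff : ∀ j ∈ A, AffineAlong symSq fun a => T (j + vert n a))
    (hc : ∀ j ∈ A, ∃ c : ℝ, ∀ i, SameFirstJet i j → Q i = c * T i) {i : Jet n 2} (hi : i ∈ A)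
    (h : T i ≠ 0 ∨ fderiv ℝ T i ≠ 0) :
    ∃ g : Jet n 1 → ℝ, ContDiffAt ℝ ∞ g (trunc 1 one_le_two i) ∧
      Q i = g (trunc 1 one_le_two i) * T i ∧
      extendFrom (nonzeroFibres T) (fibreRatio T Q) =ᶠ[𝓝 (trunc 1 one_le_two i)] g := by
  -- Fibrewise proportionality supplies the inclusion of zero sets required for smooth division.
  obtain ⟨f, hf, hfQ⟩ := exists_eventually_eq_mul hA hT hQ (fun j hj h0 => by
    obtain ⟨c, hc⟩ := hc j hj
    rw [hc j rfl, h0, mul_zero]) hi h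
  set m₀ := trunc 1 one_le_two i
  set σ := fibreSection i
  have hσ : Continuous σ := (contDiff_fibreSection i).continuous
  have hσ0 : σ m₀ = i := fibreSection_trunc i
  have hσt : ∀ m, trunc 1 one_le_two (σ m) = m := trunc_fibreSection i
  have hfcont : ∀ᶠ y in 𝓝 i, ContinuousAt f y := by
    have h1 : ContDiffAt ℝ 1 f i := hf.of_le (by simp)
    filter_upwards [h1.eventually (by simp)] with y hy using hy.continuousAt
  have hgood : ∀ᶠ y in 𝓝 i, T y ≠ 0 ∨ fderiv ℝ T y ≠ 0 := by
    rcases h with h | h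
    · filter_upwards [(hT.contDiffAt (hA.mem_nhds hi)).continuousAt.eventually_ne h] with y hy
        using Or.inl hy
    · have hT' : ContDiffOn ℝ ∞ (fderiv ℝ T) A := hT.fderiv_of_isOpen hA (by simp)
      filter_upwards [(hT'.contDiffAt (hA.mem_nhds hi)).continuousAt.eventually_ne h] with y hy
        using Or.inr hy
  have hall : ∀ᶠ m in 𝓝 m₀, σ m ∈ A ∧ ContinuousAt f (σ m) ∧
      (∀ᶠ y in 𝓝 (σ m), Q y = f y * T y) ∧ (T (σ m) ≠ 0 ∨ fderiv ℝ T (σ m) ≠ 0) :=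
    (hσ.tendsto' m₀ i hσ0).eventually ((hA.eventually_mem hi).and
      (hfcont.and (hfQ.eventually_nhds.and hgood)))
  have hratio : ∀ m, σ m ∈ A ∧ ContinuousAt f (σ m) ∧
      (∀ᶠ y in 𝓝 (σ m), Q y = f y * T y) ∧ (T (σ m) ≠ 0 ∨ fderiv ℝ T (σ m) ≠ 0) →
      m ∈ nonzeroFibres T → fibreRatio T Q m = f (σ m) := by
    rintro m ⟨hmA, hfm, hQm, -⟩ hm
    obtain ⟨c, hc⟩ := hc (σ m) hmA
    have hc' : ∀ i, trunc 1 one_le_two i = m → Q i = c * T i := fun i hi =>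
      hc i (hi.trans (hσt m).symm)
    rw [fibreRatio_eq hm hc']
    -- If `f (σ m) ≠ c`, then `c T = f T` forces `T = 0` near `σ m` in its fibre, hence on the whole
    -- fibre by unique continuation, contrary to `m ∈ nonzeroFibres T`.
    by_contra hne
    have hv : Tendsto (fun a => σ m + vert n a) (𝓝 0) (𝓝 (σ m)) :=
      (by fun_prop : Continuous fun a => σ m + vert n a).tendsto' _ _ (by simp)
    have hz : ∀ᶠ a in 𝓝 (0 : TopIdx n → ℝ), T (σ m + vert n a) = 0 := by
      filter_upwards [hv.eventually hQm, hv.eventually (hfm.eventually_ne (Ne.symm hne))]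
        with a ha1 ha2
      rw [hc _ (trunc_add_vert _ a)] at ha1
      by_contra hT0
      exact ha2 (mul_right_cancel₀ hT0 ha1).symm
    obtain ⟨i', hi', hTi'⟩ := hm
    obtain ⟨a, rfl⟩ := exists_eq_add_vert (hi'.trans (hσt m).symm)
    exact hTi' ((haff _ hmA).eq_zero_of_eventually span_range_symSq hz a)
  refine ⟨fun m => f (σ m), ContDiffAt.comp m₀ (by rw [hσ0]; exact hf)
    (contDiff_fibreSection i).contDiffAt, by beta_reduce; rw [hσ0]; exact hfQ.self_of_nhds, ?_⟩
  filter_upwards [hall.eventually_nhds] with m hm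
  obtain ⟨hmA, hfm, hQm, hgm⟩ := hm.self_of_nhds
  -- Since `T` or `dT` is nonzero at `σ m`, `T` does not vanish near it, so `m` is a limit of
  -- `nonzeroFibres T`; along that set the ratios tend to `f (σ m)`.
  refine extendFrom_eq ?_ ?_
  · have hfreq : ∃ᶠ y in 𝓝 (σ m), T y ≠ 0 := by
      intro hn
      have h0 : T =ᶠ[𝓝 (σ m)] fun _ => 0 := by
        filter_upwards [hn] with y hy
        simpa using hy
      rcases hgm with hgm | hgm
      · exact hgm h0.self_of_nhds
      · apply hgm
        rw [h0.fderiv_eq]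
        simp
    rw [mem_closure_iff_frequently]
    have ht : Tendsto (trunc (n := n) 1 one_le_two) (𝓝 (σ m)) (𝓝 m) :=
      (contDiff_trunc _).continuous.tendsto' _ _ (hσt m)
    exact ht.frequently (hfreq.mono fun y hy => ⟨y, rfl, hy⟩)
  · have hg : Tendsto (fun m => f (σ m)) (𝓝[nonzeroFibres T] m) (𝓝 (f (σ m))) :=
      (hfm.tendsto.comp hσ.continuousAt).mono_left nhdsWithin_le_nhds
    refine hg.congr' ?_
    filter_upwards [nhdsWithin_le_nhds hm, self_mem_nhdsWithin] with m' h1 h2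
    exact (hratio m' h1 h2).symm

/-- The Jacobian determinant of `φ` in the coordinates `(ψ, x¹, …, xⁿ)`. -/
noncomputable def jacobianDet (φ : (Fin n → ℝ) × ℝ → (Fin n → ℝ) × ℝ)
    (p : (Fin n → ℝ) × ℝ) : ℝ :=
  (Matrix.of fun a b : Fin (n + 1) =>
    (Fin.cons (fderiv ℝ φ p (fun c => (Pi.single b 1 : Fin (n + 1) → ℝ) c.succ,
      (Pi.single b 1 : Fin (n + 1) → ℝ) 0)).2
      (fderiv ℝ φ p (fun c => (Pi.single b 1 : Fin (n + 1) → ℝ) c.succ,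
        (Pi.single b 1 : Fin (n + 1) → ℝ) 0)).1 : Fin (n + 1) → ℝ) a).det

theorem contDiffOn_jacobianDet (hS : IsOpen S) {φ : (Fin n → ℝ) × ℝ → (Fin n → ℝ) × ℝ}
    (hφ : ContDiffOn ℝ ∞ φ S) : ContDiffOn ℝ ∞ (jacobianDet φ) S := by
  have h : ∀ v, ContDiffOn ℝ ∞ (fun p => fderiv ℝ φ p v) S := fun v =>
    (hφ.fderiv_of_isOpen hS (by simp)).clm_apply contDiffOn_const
  refine contDiffOn_det fun a b => ?_
  refine Fin.cases ?_ (fun c => ?_) a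
  · simpa using (h _).snd
  · simpa using contDiffOn_pi.1 (h _).fst c

/-- The lift covers `φ`, so on `(dψ, dx)` its differential acts through that of `φ`; the form
acquires the determinant of this action. -/
theorem pullback_eqForm (hS : IsOpen S) {φ : (Fin n → ℝ) × ℝ → (Fin n → ℝ) × ℝ}
    (hφ : ContDiffOn ℝ ∞ φ S) {j : Jet n 2} (hj : j ∈ liftDomain S φ) :
    pullback (lift 2 φ) (eqForm T) j = (T (lift 2 φ j) * jacobianDet φ (pt j)) •
      (Matrix.detRowAlternating (n := Fin (n + 1)) (R := ℝ)).compLinearMap (coframe n 2) := by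
  let C : (Fin n → ℝ) × ℝ →ₗ[ℝ] Fin (n + 1) → ℝ :=
    { toFun := fun p => Fin.cons p.2 p.1
      map_add' := fun p q => by
        ext a; refine Fin.cases ?_ (fun b => ?_) a <;> simp
      map_smul' := fun c p => by
        ext a; refine Fin.cases ?_ (fun b => ?_) a <;> simp }
  let D : (Fin (n + 1) → ℝ) →ₗ[ℝ] (Fin n → ℝ) × ℝ :=
    { toFun := fun f => (fun c => f c.succ, f 0)
      map_add' := fun _ _ => rfl
      map_smul' := fun _ _ => rfl }
  let M : (Fin (n + 1) → ℝ) →ₗ[ℝ] Fin (n + 1) → ℝ :=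
    C ∘ₗ (fderiv ℝ φ (pt j)).toLinearMap ∘ₗ D
  have hdet : LinearMap.det M = jacobianDet φ (pt j) := by
    rw [← LinearMap.det_toMatrix']
    rfl
  let p : Jet n 2 →L[ℝ] (Fin n → ℝ) × ℝ := (ContinuousLinearMap.fst ℝ _ _).prod
    ((ContinuousLinearMap.proj (R := ℝ) (φ := fun _ : MIdx n 2 => ℝ) ⟨0, by simp⟩).comp
      (ContinuousLinearMap.snd ℝ _ _))
  have hp : ∀ i, p i = pt i := fun _ => rfl
  have hchain : ∀ v, pt (fderiv ℝ (lift 2 φ) j v) = fderiv ℝ φ (pt j) (pt v) := by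
    intro v
    have hl : DifferentiableAt ℝ (lift 2 φ) j :=
      ((contDiffOn_lift hS hφ).contDiffAt ((isOpen_liftDomain hS hφ).mem_nhds
        hj)).differentiableAt (by simp)
    have hd : DifferentiableAt ℝ φ (p j) :=
      (hφ.contDiffAt (hS.mem_nhds hj.1)).differentiableAt (by simp)
    have h1 : HasFDerivAt (fun i => p (lift 2 φ i)) (p.comp (fderiv ℝ (lift 2 φ) j)) j :=
      p.hasFDerivAt.comp j hl.hasFDerivAt
    have h2 : HasFDerivAt (fun i => φ (p i)) ((fderiv ℝ φ (p j)).comp p) j :=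
      hd.hasFDerivAt.comp j p.hasFDerivAt
    have h3 : (fun i => p (lift 2 φ i)) = fun i => φ (p i) := funext fun i => pt_lift 2 φ i
    rw [h3] at h1
    exact congrArg (fun A : Jet n 2 →L[ℝ] (Fin n → ℝ) × ℝ => A v) (h1.unique h2)
  have hM : ∀ v, coframe n 2 (fderiv ℝ (lift 2 φ) j v) = M (coframe n 2 v) := by
    intro v
    change C (pt (fderiv ℝ (lift 2 φ) j v)) = C (fderiv ℝ φ (pt j) (D (C (pt v))))
    rw [hchain]
    rfl
  ext v
  change T (lift 2 φ j) * Matrix.detRowAlternating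
      (fun a => coframe n 2 (fderiv ℝ (lift 2 φ) j (v a))) =
    (T (lift 2 φ j) * jacobianDet φ (pt j)) *
      Matrix.detRowAlternating (fun a => coframe n 2 (v a))
  have := (Pi.basisFun ℝ (Fin (n + 1))).det_comp M fun a => coframe n 2 (v a)
  rw [Pi.basisFun_det, hdet] at this
  simp only [hM]
  rw [mul_assoc, ← this]
  rfl

end ScalarJet

/-! ### Assembly of the multiplier -/

open ScalarJet
theorem theorem4 (n : ℕ) (S : Set ((Fin n → ℝ) × ℝ)) (hS : IsOpen S)
    (T : Jet n 2 → ℝ) (hT : ContDiffOn ℝ ∞ T (jetsOver S 2)) (hvar : LocallyVariational S T)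
    (φ : OpenPartialHomeomorph ((Fin n → ℝ) × ℝ) ((Fin n → ℝ) × ℝ)) (hφ : IsDiffeoOf S φ)
    (𝒰 : Set (Set (Fin n → ℝ)))
    (hsolv : ∀ j ∈ jetsOver S 2, T j = 0 → j ∈ closure (solutionJets S T 𝒰))
    (hsym : MapsSolutions S T 𝒰 φ)
    (hreg : MapsSolutions S T 𝒰 φ.symm ∨
      ∀ j ∈ jetsOver S 2, ∃ i : Jet n 2, SameFirstJet i j ∧ T i = 0) :
    ∃ ρ : Jet n 2 → ℝ,
      (∀ j ∈ liftDomain S φ, pullback (lift 2 φ) (eqForm T) j = ρ j • eqForm T j) ∧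
      (∀ j ∈ liftDomain S φ, ∀ μ ν : Fin n,
        HasLineDerivAt ℝ ρ 0 j (eU ⟨{μ, ν}, by simp⟩)) ∧
      (∀ j ∈ liftDomain S φ,
        (∃ i : Jet n 2, SameFirstJet i j ∧ (T i ≠ 0 ∨ fderiv ℝ T i ≠ 0)) →
        ContDiffAt ℝ ∞ ρ j) := by
  have hA := isOpen_liftDomain hS hφ.2.2.1
  set A := liftDomain S φ
  set Q : Jet n 2 → ℝ := fun i => T (lift 2 φ i)
  have hTA : ContDiffOn ℝ ∞ T A := hT.mono fun i hi => hi.1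
  have hQA : ContDiffOn ℝ ∞ Q A :=
    hT.comp (contDiffOn_lift hS hφ.2.2.1) fun i hi => hφ.lift_mem_jetsOver hi.1
  have hAf : ∀ i j, SameFirstJet i j → j ∈ A → i ∈ A := fun i j h hj => h.mem_liftDomain hj
  have hAv : ∀ j ∈ A, ∀ a, j + vert n a ∈ A := fun j hj a => hAf _ _ (trunc_add_vert j a) hj
  have hc : ∀ j ∈ A, ∃ c : ℝ, ∀ i, SameFirstJet i j → Q i = c * T i := by
    intro j hj
    obtain ⟨c, hc⟩ := AffineAlong.exists_eq_const_mul span_range_symSq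
      ⟨_, symSq_add_smul⟩ (affineAlong_fibre hS hT hvar hj.1)
      (affineAlong_fibre_lift hS hT hvar hφ hj) (contDiff_fibre hTA (hAv j hj))
      (contDiff_fibre hQA (hAv j hj))
      (fun a h0 => hφ.apply_lift_eq_zero hS hT hsolv hsym (hAv j hj a) h0) (by
        rcases hreg with hsymm | hzero
        · exact Or.inr fun a h0 => hφ.eq_zero_of_apply_lift hS hT hsolv hsymm (hAv j hj a) h0
        · obtain ⟨i, hi, h0⟩ := hzero j hj.1
          obtain ⟨a, rfl⟩ := exists_eq_add_vert hi
          exact Or.inl ⟨a, h0⟩)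
    refine ⟨c, fun i hi => ?_⟩
    obtain ⟨a, rfl⟩ := exists_eq_add_vert hi
    exact hc a
  have hext : ∀ {i}, i ∈ A → T i ≠ 0 ∨ fderiv ℝ T i ≠ 0 → _ := fun {i} hi h =>
    exists_contDiffAt_extendFrom hA hTA hQA
      (fun j hj => affineAlong_fibre hS hT hvar hj.1) hc hi h
  -- The limit is taken within `nonzeroFibres T`, so the default value of `fibreRatio` off that set
  -- never enters.
  set r := extendFrom (nonzeroFibres T) (fibreRatio T Q)
  refine ⟨fun j => jacobianDet φ (pt j) * r (trunc 1 one_le_two j), fun j hj => ?_,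
    fun j hj μ ν => ?_, ?_⟩
  · have hQj : T (lift 2 φ j) = r (trunc 1 one_le_two j) * T j := by
      -- At a zero of `T` both sides vanish whatever `r` is; elsewhere `T j ≠ 0` puts `j` in the
      -- scope of the division argument.
      by_cases h0 : T j = 0
      · obtain ⟨c, hcj⟩ := hc j hj
        rw [h0, mul_zero]
        exact (hcj j rfl).trans (by rw [h0, mul_zero])
      · obtain ⟨g, -, hQg, hrg⟩ := hext hj (Or.inl h0)
        rw [hrg.self_of_nhds]
        exact hQg
    rw [pullback_eqForm hS hφ.2.2.1 hj, eqForm, smul_smul, hQj]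
    congr 1
    ring
  · have hsame : ∀ t : ℝ, trunc 1 one_le_two (j + t • eU ⟨{μ, ν}, by simp⟩) =
        trunc 1 one_le_two j := by
      intro t
      refine Prod.ext (by simp [trunc, eU]) (funext fun s => ?_)
      have hs : (⟨s.1, s.2.trans one_le_two⟩ : MIdx n 2) ≠ ⟨{μ, ν}, by simp⟩ := by
        intro h
        have h1 := s.2
        have h2 : s.1 = {μ, ν} := congrArg Subtype.val h
        rw [h2] at h1
        simp at h1
      change j.2 _ + t * (Pi.single _ 1 : MIdx n 2 → ℝ) _ = j.2 _
      rw [Pi.single_eq_of_ne hs, mul_zero, add_zero]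
    have hpt : ∀ t : ℝ, pt (j + t • eU ⟨{μ, ν}, by simp⟩) = pt j := fun t =>
      congrArg (fun m : Jet n 1 => pt m) (hsame t)
    simp only [HasLineDerivAt, hsame, hpt]
    exact hasDerivAt_const _ _
  · rintro j hj ⟨i, hij, hi⟩
    -- Any good point `i` of the fibre suffices, because `r` is a function of the first-order jet
    -- shared by `i` and `j`.
    obtain ⟨g, hg, -, hrg⟩ := hext (hAf i j hij hj) hi
    rw [show trunc 1 one_le_two i = trunc 1 one_le_two j from hij] at hg hrg
    have hδ : ContDiffAt ℝ ∞ (fun j : Jet n 2 => jacobianDet φ (pt j)) j :=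
      ContDiffAt.comp (g := jacobianDet φ) (f := pt) j
        ((contDiffOn_jacobianDet hS hφ.2.2.1).contDiffAt (hS.mem_nhds hj.1)) contDiff_pt.contDiffAt
    refine (hδ.mul (ContDiffAt.comp j hg (contDiff_trunc _).contDiffAt)).congr_of_eventuallyEq ?_
    filter_upwards [(contDiff_trunc (n := n) one_le_two).continuous.continuousAt.eventually hrg]
      with y hy
    simp only [Function.comp, hy]
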